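/- Let $\mathfrak g$ be a finite-dimensional complex semisimple Lie algebra with Cartan subalgebra $\mathfrak h$, simple roots $\alpha\in\Pi^+$, Chevalley generators $e_\alpha,f_\alpha$, and let $(\cdot,\cdot)$ be a non-zero rational multiple of the Killing form on $\mathfrak h$, transferred to $\mathfrak h^*$. Fix $\hbar\in\mathbb C$ such that $q=e^{\hbar}$ is not a root of unity, and write $q^x=e^{\hbar x}$. Let $U=U_q(\mathfrak g)$ be the quantum group with generators $e_\alpha,f_\alpha,q^{\pm h_\alpha}$ ($\alpha\in\Pi^+$) and relations $q^{h_\alpha}q^{-h_\alpha}=1=q^{-h_\alpha}q^{h_\alpha}$, the $q^{\pm h_\alpha}$ commute with each other, $q^{\pm h_\alpha}e_\beta=q^{\pm(\alpha,\beta)}e_\beta q^{\pm h_\alpha}$, $q^{\pm h_\alpha}f_\beta=q^{\mp(\alpha,\beta)}f_\beta q^{\pm h_\alpha}$, $[e_\alpha,f_\beta]=\delta_{\alpha\beta}\frac{q^{h_\alpha}-q^{-h_\alpha}}{q-q^{-1}}$, and the quantum Serre relations. The comultiplication is $\Delta(e_\alpha)=e_\alpha\otimes q^{h_\alpha}+1\otimes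 e_\alpha$, $\Delta(f_\alpha)=f_\alpha\otimes1+q^{-h_\alpha}\otimes f_\alpha$, $\Delta(q^{\pm h_\alpha})=q^{\pm h_\alpha}\otimes q^{\pm h_\alpha}$, and $\sigma$ is the algebra automorphism of $U$ with $e_\alpha\mapsto f_\alpha$, $f_\alpha\mapsto e_\alpha$, $q^{h_\alpha}\mapsto q^{-h_\alpha}$. Let $U(\mathfrak g_+)$ and $U(\mathfrak g_-)$ be the subalgebras of $U$ generated by the $e_\alpha$ and by the $f_\alpha$, respectively. A vector $v$ has weight $\mu\in\mathfrak h^*$ if $q^{h_\alpha}v=q^{(\alpha,\mu)}v$ for all $\alpha\in\Pi^+$. Let $V$ and $Z$ be irreducible highest weight $U$-modules with highest vectors $1_\nu\in V$, $1_\zeta\in Z$ of weights $\nu,\zeta\in\mathfrak h^*$. Let $I^-_Z\subset U(\mathfrak g_-)$ be the annihilator of $1_\zeta$, let $I^+_Z=\sigma(I^-_Z)$, a left ideal of $U(\mathfrak g_+)$, and let $V^+_Z=\{v\in V: xv=0\ \text{for all } x\in I^+_Z\}$ be its kernel in $V$. Define $I^\pm_V$ (from $1_\nu$) and $Z^+_V=\{z\in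 Z: xz=0\ \text{for all }x\in I^+_V\}$ in the same way. Let $(V\otimes Z)^+$ be the span of the singular vectors of $V\otimes Z$, that is, of the non-zero weight vectors annihilated by all $e_\alpha$ (acting through $\Delta$). Then there are a unique linear functional ${}^*1_\nu$ on $V$ with ${}^*1_\nu(1_\nu)=1$ and ${}^*1_\nu(q^{h_\alpha}v)=q^{(\alpha,\nu)}\,{}^*1_\nu(v)$ for all $\alpha\in\Pi^+$, $v\in V$, and a unique linear functional ${}^*1_\zeta$ on $Z$ with the analogous properties, and the maps that take leading coefficients, $v\otimes z\mapsto {}^*1_\zeta(z)\,v$ and $v\otimes z\mapsto {}^*1_\nu(v)\,z$, restrict to linear isomorphisms $$(V\otimes Z)^+\;\xrightarrow{\ \sim\ }\;V^+_Z,\qquad (V\otimes Z)^+\;\xrightarrow{\ \sim\ }\;Z^+_V .$$ The same holds in the classical case, where $U=U(\mathfrak g)$ is the universal enveloping algebra, $\Delta(x)=x\otimes1+1\otimes x$ for $x\in\mathfrak g$, $\sigma$ is the automorphism that interchanges $e_\alpha$ and $f_\alpha$, a vector $v$ has weight $\mu$ if $hv=\mu(h)v$ for all $h\in\mathfrak h$,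 and the functionals are normalized by ${}^*1_\nu(1_\nu)=1$, ${}^*1_\nu(hv)=\nu(h)\,{}^*1_\nu(v)$ for all $h\in\mathfrak h$, $v\in V$, and likewise for ${}^*1_\zeta$. -/

import Mathlib

open scoped TensorProduct

noncomputable section

namespace Extremal

/-! ### Notions common to the quantum and the classical case

`U` is the (quantized) universal enveloping algebra, `e`, `f` are its families of positive and
negative Chevalley generators, and `t` is a family of generators of its Cartan part. A weight
is recorded through the eigenvalues `χ` of the elements `t s`. -/

section Common

variable {ι τ W : Type*} {U : Type*} [Ring U] [Algebra ℂ U]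
variable {V : Type*} [AddCommGroup V] [Module ℂ V] [Module U V] [IsScalarTower ℂ U V]
variable {Z : Type*} [AddCommGroup Z] [Module ℂ Z] [Module U Z] [IsScalarTower ℂ U Z]

/-- `v` is a highest vector of weight `χ`, and it generates the module `V`. -/
def IsHighestVector (t : τ → U) (e : ι → U) (χ : τ → ℂ) (v : V) : Prop :=
  v ≠ 0 ∧ (∀ s, t s • v = χ s • v) ∧ (∀ i, e i • v = 0) ∧ Submodule.span U {v} = ⊤

/-- `φ` is the lowest vector of the restricted dual of `V` that is dual to the highest vector `v`
of weight `χ`: it takes the value `1` on `v`, and it has weight opposite to `χ`, that is, it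
vanishes on all weight spaces other than that of `χ`. -/
def IsDualLowestVector (t : τ → U) (χ : τ → ℂ) (v : V) (φ : Module.Dual ℂ V) : Prop :=
  φ v = 1 ∧ ∀ s x, φ (t s • x) = χ s * φ x

/-- The action of `U ⊗ U` on `V ⊗ Z`, `(x ⊗ y)(v ⊗ z) = x v ⊗ y z`. -/
def tensorAction (U V Z : Type*) [Ring U] [Algebra ℂ U]
    [AddCommGroup V] [Module ℂ V] [Module U V] [IsScalarTower ℂ U V]
    [AddCommGroup Z] [Module ℂ Z] [Module U Z] [IsScalarTower ℂ U Z] :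
    U ⊗[ℂ] U →ₐ[ℂ] Module.End ℂ (V ⊗[ℂ] Z) :=
  (Module.endTensorEndAlgHom (R := ℂ) (S := ℂ) (A := ℂ) (M := V) (N := Z)).comp
    (Algebra.TensorProduct.map (Algebra.lsmul ℂ ℂ V) (Algebra.lsmul ℂ ℂ Z))

/-- The span of the singular vectors in `V ⊗ Z`: the non-zero weight vectors annihilated by the
positive Chevalley generators. Here `Δt s` and `Δe i` are the comultiplications of the Cartan
generators and of the positive generators, and `wt μ` is the system of eigenvalues that
belongs to the weight `μ`. -/
def singularSpan (V Z : Type*)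
    [AddCommGroup V] [Module ℂ V] [Module U V] [IsScalarTower ℂ U V]
    [AddCommGroup Z] [Module ℂ Z] [Module U Z] [IsScalarTower ℂ U Z]
    (Δt : τ → U ⊗[ℂ] U) (Δe : ι → U ⊗[ℂ] U) (wt : W → τ → ℂ) :
    Submodule ℂ (V ⊗[ℂ] Z) :=
  Submodule.span ℂ {u | u ≠ 0 ∧
    (∃ μ : W, ∀ s, tensorAction U V Z (Δt s) u = wt μ s • u) ∧
    ∀ i, tensorAction U V Z (Δe i) u = 0}

/-- The subalgebra generated by a family: `U(𝔤₊)` for `e`, `U(𝔤₋)` for `f`. -/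
abbrev gen (x : ι → U) : Subalgebra ℂ U := Algebra.adjoin ℂ (Set.range x)

/-- The left ideal `I⁻` of `U(𝔤₋)`, the annihilator of the vector `z`. -/
def annMinus (f : ι → U) (z : Z) : Ideal (gen f) :=
  Ideal.torsionOf (gen f) Z z

/-- The kernel in `V` of a left ideal of the subalgebra `A`: the vectors killed by all its
elements. -/
def idealKer {A : Subalgebra ℂ U} (I : Ideal A) (V : Type*)
    [AddCommGroup V] [Module ℂ V] [Module U V] [IsScalarTower ℂ U V] : Submodule ℂ V where
  carrier := {v | ∀ x ∈ I, (x : U) • v = 0}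
  zero_mem' := fun x _ => smul_zero (x : U)
  add_mem' := fun {v w} hv hw x hx => by rw [smul_add, hv x hx, hw x hx, add_zero]
  smul_mem' := fun a v hv x hx => by rw [smul_comm, hv x hx, smul_zero]

/-- `v ⊗ z ↦ ψ(z) v`; for `ψ` the dual lowest vector of `Z` this is the leading `V`-coefficient. -/
def leadingLeft (V : Type*) [AddCommGroup V] [Module ℂ V] (ψ : Module.Dual ℂ Z) :
    V ⊗[ℂ] Z →ₗ[ℂ] V :=
  (TensorProduct.rid ℂ V).toLinearMap ∘ₗ ψ.lTensor V

/-- `v ⊗ z ↦ φ(v) z`; for `φ` the dual lowest vector of `V` this is the leading `Z`-coefficient. -/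
def leadingRight (Z : Type*) [AddCommGroup Z] [Module ℂ Z] (φ : Module.Dual ℂ V) :
    V ⊗[ℂ] Z →ₗ[ℂ] Z :=
  (TensorProduct.lid ℂ Z).toLinearMap ∘ₗ φ.rTensor Z

end Common

/-! ### The inner product -/

section InnerProduct

variable {𝔤 : Type*} [LieRing 𝔤] [LieAlgebra ℂ 𝔤] [FiniteDimensional ℂ 𝔤]
  [LieAlgebra.IsSemisimple ℂ 𝔤] {H : LieSubalgebra ℂ 𝔤} [H.IsCartanSubalgebra]

/-- The element `h_lam` of the Cartan subalgebra that corresponds to `lam ∈ 𝔥*` under the inner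
product `c • Killing` on `𝔥`. -/
def hElt (c : ℚ) (lam : Module.Dual ℂ H) : H :=
  (c : ℂ)⁻¹ • (LieAlgebra.IsKilling.cartanEquivDual H).symm lam

/-- The inner product on `𝔥*`, transferred from `c • Killing` on `𝔥`: `(μ, lam) = μ(h_lam)`. -/
def dualForm (c : ℚ) (μ lam : Module.Dual ℂ H) : ℂ := μ (hElt c lam)

/-- `hElt` is the transfer along `c • Killing`. -/
theorem killing_hElt (c : ℚ) (hc : c ≠ 0) (lam : Module.Dual ℂ H) (x : H) :
    (c : ℂ) * killingForm ℂ 𝔤 (hElt c lam : H) x = lam x := by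
  have hc' : (c : ℂ) ≠ 0 := by exact_mod_cast hc
  have h := LinearMap.congr_fun
    ((LieAlgebra.IsKilling.cartanEquivDual H).apply_symm_apply lam) x
  have h2 : killingForm ℂ 𝔤
      (((LieAlgebra.IsKilling.cartanEquivDual H).symm lam : H) : 𝔤) x = lam x := h
  have h3 : ((hElt c lam : H) : 𝔤)
      = (c : ℂ)⁻¹ • (((LieAlgebra.IsKilling.cartanEquivDual H).symm lam : H) : 𝔤) := rfl
  rw [h3, map_smul, LinearMap.smul_apply, h2, smul_eq_mul, mul_inv_cancel_left₀ hc']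

end InnerProduct

/-! ### The quantum group -/

section Quantum

/-- The complex power `q ^ x` of `q = exp ħ`. -/
def qpow (ħ x : ℂ) : ℂ := Complex.exp (ħ * x)

/-- The quantum integer `[n]` at the parameter `p`. -/
def qInt (p : ℂ) (n : ℕ) : ℂ := (p ^ n - p⁻¹ ^ n) / (p - p⁻¹)

/-- The quantum factorial `[n]!` at the parameter `p`. -/
def qFactorial (p : ℂ) (n : ℕ) : ℂ := ∏ j ∈ Finset.range n, qInt p (j + 1)

/-- The quantum binomial coefficient at the parameter `p`. -/
def qBinom (p : ℂ) (m r : ℕ) : ℂ := qFactorial p m / (qFactorial p r * qFactorial p (m - r))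

/-- Names of the generators `e_α`, `f_α`, `q^{h_α}`, `q^{-h_α}`. -/
inductive QGen (ι : Type*)
  | e : ι → QGen ι
  | f : ι → QGen ι
  | k : ι → QGen ι
  | kInv : ι → QGen ι

/-- The left-hand side of a quantum Serre relation,
`∑ (-1)^r [m choose r]_p x^(m-r) y x^r`. -/
def serre {R : Type*} [Ring R] [Algebra ℂ R] (p : ℂ) (m : ℕ) (x y : R) : R :=
  ∑ r ∈ Finset.range (m + 1), ((-1) ^ r * qBinom p m r) • (x ^ (m - r) * y * x ^ r)

theorem map_serre {R S : Type*} [Ring R] [Algebra ℂ R] [Ring S] [Algebra ℂ S]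
    (φ : R →ₐ[ℂ] S) (p : ℂ) (m : ℕ) (x y : R) :
    φ (serre p m x y) = serre p m (φ x) (φ y) := by
  simp [serre]

variable {ι : Type*}

/-- The defining relations of the quantum group. `B i j = (α_i, α_j)`, and
`A i j = ⟨α_i, α_j^∨⟩`, so that the Serre relation between `e_i` and `e_j` has degree
`1 - ⟨α_j, α_i^∨⟩ = 1 - A j i` in `e_i`, with parameter `q_i = q^{(α_i, α_i)/2}`. -/
inductive QRel (ħ : ℂ) (A : Matrix ι ι ℤ) (B : ι → ι → ℂ) :
    FreeAlgebra ℂ (QGen ι) → FreeAlgebra ℂ (QGen ι) → Prop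
  | k_kInv (i : ι) : QRel ħ A B (FreeAlgebra.ι ℂ (.k i) * FreeAlgebra.ι ℂ (.kInv i)) 1
  | kInv_k (i : ι) : QRel ħ A B (FreeAlgebra.ι ℂ (.kInv i) * FreeAlgebra.ι ℂ (.k i)) 1
  | k_k (i j : ι) : QRel ħ A B
      (FreeAlgebra.ι ℂ (.k i) * FreeAlgebra.ι ℂ (.k j))
      (FreeAlgebra.ι ℂ (.k j) * FreeAlgebra.ι ℂ (.k i))
  | kInv_kInv (i j : ι) : QRel ħ A B
      (FreeAlgebra.ι ℂ (.kInv i) * FreeAlgebra.ι ℂ (.kInv j))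
      (FreeAlgebra.ι ℂ (.kInv j) * FreeAlgebra.ι ℂ (.kInv i))
  | k_e (i j : ι) : QRel ħ A B
      (FreeAlgebra.ι ℂ (.k i) * FreeAlgebra.ι ℂ (.e j))
      (qpow ħ (B i j) • (FreeAlgebra.ι ℂ (.e j) * FreeAlgebra.ι ℂ (.k i)))
  | kInv_e (i j : ι) : QRel ħ A B
      (FreeAlgebra.ι ℂ (.kInv i) * FreeAlgebra.ι ℂ (.e j))
      (qpow ħ (-B i j) • (FreeAlgebra.ι ℂ (.e j) * FreeAlgebra.ι ℂ (.kInv i)))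
  | k_f (i j : ι) : QRel ħ A B
      (FreeAlgebra.ι ℂ (.k i) * FreeAlgebra.ι ℂ (.f j))
      (qpow ħ (-B i j) • (FreeAlgebra.ι ℂ (.f j) * FreeAlgebra.ι ℂ (.k i)))
  | kInv_f (i j : ι) : QRel ħ A B
      (FreeAlgebra.ι ℂ (.kInv i) * FreeAlgebra.ι ℂ (.f j))
      (qpow ħ (B i j) • (FreeAlgebra.ι ℂ (.f j) * FreeAlgebra.ι ℂ (.kInv i)))
  | e_f (i : ι) : QRel ħ A B
      (FreeAlgebra.ι ℂ (.e i) * FreeAlgebra.ι ℂ (.f i)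
        - FreeAlgebra.ι ℂ (.f i) * FreeAlgebra.ι ℂ (.e i))
      ((qpow ħ 1 - qpow ħ (-1))⁻¹ •
        (FreeAlgebra.ι ℂ (.k i) - FreeAlgebra.ι ℂ (.kInv i)))
  | e_f_ne (i j : ι) (hij : i ≠ j) : QRel ħ A B
      (FreeAlgebra.ι ℂ (.e i) * FreeAlgebra.ι ℂ (.f j))
      (FreeAlgebra.ι ℂ (.f j) * FreeAlgebra.ι ℂ (.e i))
  | serre_e (i j : ι) (hij : i ≠ j) : QRel ħ A B
      (serre (qpow ħ (B i i / 2)) (1 - A j i).toNat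
        (FreeAlgebra.ι ℂ (.e i)) (FreeAlgebra.ι ℂ (.e j))) 0
  | serre_f (i j : ι) (hij : i ≠ j) : QRel ħ A B
      (serre (qpow ħ (B i i / 2)) (1 - A j i).toNat
        (FreeAlgebra.ι ℂ (.f i)) (FreeAlgebra.ι ℂ (.f j))) 0

/-- The algebra presented by the generators `QGen` and the relations `QRel`. -/
abbrev QAlg (ħ : ℂ) (A : Matrix ι ι ℤ) (B : ι → ι → ℂ) := RingQuot (QRel ħ A B)

namespace QAlg

variable (ħ : ℂ) (A : Matrix ι ι ℤ) (B : ι → ι → ℂ)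

/-- The generators as elements of the quantum group. -/
def of (g : QGen ι) : QAlg ħ A B := RingQuot.mkAlgHom ℂ (QRel ħ A B) (FreeAlgebra.ι ℂ g)

/-- The positive Chevalley generators `e_α`. -/
abbrev e (i : ι) : QAlg ħ A B := of ħ A B (.e i)

/-- The negative Chevalley generators `f_α`. -/
abbrev f (i : ι) : QAlg ħ A B := of ħ A B (.f i)

/-- The Cartan generators `q^{h_α}`. -/
abbrev k (i : ι) : QAlg ħ A B := of ħ A B (.k i)

/-- The Cartan generators `q^{-h_α}`. -/
abbrev kInv (i : ι) : QAlg ħ A B := of ħ A B (.kInv i)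

/-- The permutation of the generators that underlies `σ`. -/
def flip : QGen ι → QGen ι
  | .e i => .f i
  | .f i => .e i
  | .k i => .kInv i
  | .kInv i => .k i

theorem of_rel {x y : FreeAlgebra ℂ (QGen ι)} (h : QRel ħ A B x y) :
    RingQuot.mkAlgHom ℂ (QRel ħ A B) x = RingQuot.mkAlgHom ℂ (QRel ħ A B) y :=
  RingQuot.mkAlgHom_rel ℂ h

/-- `σ` as an algebra homomorphism. -/
def sigmaHom : QAlg ħ A B →ₐ[ℂ] QAlg ħ A B :=
  RingQuot.liftAlgHom ℂ ⟨FreeAlgebra.lift ℂ (fun g => of ħ A B (flip g)), by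
    intro x y h
    cases h with
    | k_kInv i => simpa [flip, of] using of_rel ħ A B (.kInv_k i)
    | kInv_k i => simpa [flip, of] using of_rel ħ A B (.k_kInv i)
    | k_k i j => simpa [flip, of] using of_rel ħ A B (.kInv_kInv i j)
    | kInv_kInv i j => simpa [flip, of] using of_rel ħ A B (.k_k i j)
    | k_e i j => simpa [flip, of] using of_rel ħ A B (.kInv_f i j)
    | kInv_e i j => simpa [flip, of] using of_rel ħ A B (.k_f i j)
    | k_f i j => simpa [flip, of] using of_rel ħ A B (.kInv_e i j)
    | kInv_f i j => simpa [flip, of] using of_rel ħ A B (.k_e i j)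
    | e_f i =>
      have h := congrArg Neg.neg (of_rel ħ A B (.e_f i))
      simp only [map_sub, map_mul, map_smul, FreeAlgebra.lift_ι_apply, flip, of, neg_sub]
        at h ⊢
      rw [h]
      exact (smul_neg _ _).symm.trans (congrArg _ (neg_sub _ _))
    | e_f_ne i j hij => simpa [flip, of] using (of_rel ħ A B (.e_f_ne j i hij.symm)).symm
    | serre_e i j hij =>
      have h := of_rel ħ A B (.serre_f i j hij)
      simp only [map_serre, map_zero, FreeAlgebra.lift_ι_apply, flip, of] at h ⊢
      exact h
    | serre_f i j hij =>
      have h := of_rel ħ A B (.serre_e i j hij)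
      simp only [map_serre, map_zero, FreeAlgebra.lift_ι_apply, flip, of] at h ⊢
      exact h⟩

@[simp] theorem sigmaHom_of (g : QGen ι) : sigmaHom ħ A B (of ħ A B g) = of ħ A B (flip g) := by
  simp [sigmaHom, of]

theorem sigmaHom_comp : (sigmaHom ħ A B).comp (sigmaHom ħ A B) = AlgHom.id ℂ _ := by
  apply RingQuot.ringQuot_ext'
  apply FreeAlgebra.hom_ext
  funext g
  change sigmaHom ħ A B (sigmaHom ħ A B (of ħ A B g)) = of ħ A B g
  cases g <;> simp [flip]

/-- The involutive algebra automorphism `σ`: `e_α ↦ f_α`, `f_α ↦ e_α`,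
`q^{h_α} ↦ q^{-h_α}`. -/
def sigma : QAlg ħ A B ≃ₐ[ℂ] QAlg ħ A B :=
  AlgEquiv.ofAlgHom (sigmaHom ħ A B) (sigmaHom ħ A B) (sigmaHom_comp ħ A B) (sigmaHom_comp ħ A B)

@[simp] theorem sigma_of (g : QGen ι) : sigma ħ A B (of ħ A B g) = of ħ A B (flip g) :=
  sigmaHom_of ħ A B g

theorem map_sigma_gen : (gen (f ħ A B)).map (sigma ħ A B : QAlg ħ A B →ₐ[ℂ] QAlg ħ A B)
    = gen (e ħ A B) := by
  rw [gen, AlgHom.map_adjoin, ← Set.range_comp]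
  congr 2
  funext i
  simp [flip]

/-- The restriction of `σ` to an isomorphism from `U_q(𝔤₋)` to `U_q(𝔤₊)`. -/
def sigmaMinus : gen (f ħ A B) ≃ₐ[ℂ] gen (e ħ A B) :=
  ((sigma ħ A B).subalgebraMap (gen (f ħ A B))).trans
    (Subalgebra.equivOfEq _ _ (map_sigma_gen ħ A B))

theorem coe_sigmaMinus (x : gen (f ħ A B)) :
    (sigmaMinus ħ A B x : QAlg ħ A B) = sigma ħ A B (x : QAlg ħ A B) := rfl

/-- The left ideal `I⁺ = σ(I⁻)` of `U_q(𝔤₊)`, where `I⁻` is the annihilator of `z` in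
`U_q(𝔤₋)`. -/
def idealPlus {Z : Type*} [AddCommGroup Z] [Module ℂ Z] [Module (QAlg ħ A B) Z]
    [IsScalarTower ℂ (QAlg ħ A B) Z] (z : Z) : Ideal (gen (e ħ A B)) :=
  (annMinus (f ħ A B) z).map (sigmaMinus ħ A B)

/-- The comultiplication on the generators:
`Δ(e) = e ⊗ q^h + 1 ⊗ e`, `Δ(f) = f ⊗ 1 + q^{-h} ⊗ f`, `Δ(q^{±h}) = q^{±h} ⊗ q^{±h}`. -/
def comul : QGen ι → QAlg ħ A B ⊗[ℂ] QAlg ħ A B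
  | .e i => e ħ A B i ⊗ₜ[ℂ] k ħ A B i + 1 ⊗ₜ[ℂ] e ħ A B i
  | .f i => f ħ A B i ⊗ₜ[ℂ] 1 + kInv ħ A B i ⊗ₜ[ℂ] f ħ A B i
  | .k i => k ħ A B i ⊗ₜ[ℂ] k ħ A B i
  | .kInv i => kInv ħ A B i ⊗ₜ[ℂ] kInv ħ A B i

end QAlg

variable [Fintype ι] {𝔤 : Type*} [LieRing 𝔤] [LieAlgebra ℂ 𝔤] [FiniteDimensional ℂ 𝔤]
  [LieAlgebra.IsSemisimple ℂ 𝔤] {H : LieSubalgebra ℂ 𝔤} [H.IsCartanSubalgebra]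

/-- The matrix of inner products `(α_i, α_j)` of the simple roots. -/
def simpleForm (c : ℚ) (b : LieAlgebra.Basis ι H) (i j : ι) : ℂ :=
  dualForm c (b.baseSupp i) (b.baseSupp j)

/-- The eigenvalues `q^{(α_i, μ)}` of the elements `q^{h_{α_i}}` on vectors of weight `μ`. -/
def qWeight (ħ : ℂ) (c : ℚ) (b : LieAlgebra.Basis ι H) (μ : Module.Dual ℂ H) (i : ι) : ℂ :=
  qpow ħ (dualForm c (b.baseSupp i) μ)

/-- The quantum group `U_q(𝔤)`, `q = exp ħ`, for the semisimple Lie algebra `𝔤` with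
Cartan subalgebra `H`, Chevalley generators `b`, and the inner product `c • Killing`. -/
abbrev QuantumGroup (ħ : ℂ) (c : ℚ) (b : LieAlgebra.Basis ι H) :=
  QAlg ħ b.A (simpleForm c b)

namespace QuantumGroup

variable (ħ : ℂ) (c : ℚ) (b : LieAlgebra.Basis ι H)

/-- The positive Chevalley generators `e_α` of `U_q(𝔤)`. -/
abbrev e : ι → QuantumGroup ħ c b := QAlg.e ħ b.A (simpleForm c b)

/-- The Cartan generators `q^{h_α}` of `U_q(𝔤)`. -/
abbrev k : ι → QuantumGroup ħ c b := QAlg.k ħ b.A (simpleForm c b)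

/-- The kernel in `V` of the left ideal `I⁺ = σ(I⁻)`, `I⁻` the annihilator of `z` in `U_q(𝔤₋)`.
For the highest vector `z` of `Z` this is the extremal subspace `V⁺_Z`. -/
def extremal (V : Type*) [AddCommGroup V] [Module ℂ V] [Module (QuantumGroup ħ c b) V]
    [IsScalarTower ℂ (QuantumGroup ħ c b) V] {Z : Type*} [AddCommGroup Z] [Module ℂ Z]
    [Module (QuantumGroup ħ c b) Z] [IsScalarTower ℂ (QuantumGroup ħ c b) Z] (z : Z) :
    Submodule ℂ V :=
  idealKer (QAlg.idealPlus ħ b.A (simpleForm c b) z) V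

/-- The space `(V ⊗ Z)⁺` spanned by the singular vectors. -/
def singular (V Z : Type*) [AddCommGroup V] [Module ℂ V] [Module (QuantumGroup ħ c b) V]
    [IsScalarTower ℂ (QuantumGroup ħ c b) V] [AddCommGroup Z] [Module ℂ Z]
    [Module (QuantumGroup ħ c b) Z] [IsScalarTower ℂ (QuantumGroup ħ c b) Z] :
    Submodule ℂ (V ⊗[ℂ] Z) :=
  singularSpan V Z (fun i => QAlg.comul ħ b.A (simpleForm c b) (.k i))
    (fun i => QAlg.comul ħ b.A (simpleForm c b) (.e i)) (qWeight ħ c b)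

end QuantumGroup

end Quantum

/-! ### The classical universal enveloping algebra -/

section Classical

variable {ι : Type*} [Finite ι] {𝔤 : Type*} [LieRing 𝔤] [LieAlgebra ℂ 𝔤]
  {H : LieSubalgebra ℂ 𝔤} (b : LieAlgebra.Basis ι H)

namespace Classical

/-- The positive Chevalley generators in `U(𝔤)`. -/
def e (i : ι) : UniversalEnvelopingAlgebra ℂ 𝔤 := UniversalEnvelopingAlgebra.ι ℂ (b.e i)

/-- The negative Chevalley generators in `U(𝔤)`. -/
def f (i : ι) : UniversalEnvelopingAlgebra ℂ 𝔤 := UniversalEnvelopingAlgebra.ι ℂ (b.f i)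

/-- The elements of the Cartan subalgebra in `U(𝔤)`. -/
def t (H : LieSubalgebra ℂ 𝔤) (h : H) : UniversalEnvelopingAlgebra ℂ 𝔤 :=
  UniversalEnvelopingAlgebra.ι ℂ (h : 𝔤)

/-- The comultiplication on elements of `𝔤`: `Δ(x) = x ⊗ 1 + 1 ⊗ x`. -/
def comul (x : 𝔤) :
    UniversalEnvelopingAlgebra ℂ 𝔤 ⊗[ℂ] UniversalEnvelopingAlgebra ℂ 𝔤 :=
  UniversalEnvelopingAlgebra.ι ℂ x ⊗ₜ[ℂ] 1 + 1 ⊗ₜ[ℂ] UniversalEnvelopingAlgebra.ι ℂ x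

/-- The evaluation of non-commutative polynomials at a family of elements of an algebra, as a map
onto the subalgebra that the family generates. -/
def evalGen {U : Type*} [Ring U] [Algebra ℂ U] (x : ι → U) : FreeAlgebra ℂ ι →ₐ[ℂ] gen x :=
  FreeAlgebra.lift ℂ fun i => ⟨x i, Algebra.subset_adjoin (Set.mem_range_self i)⟩

/-- The left ideal `I⁺ = σ(I⁻)` of `U(𝔤₊)`, where `I⁻` is the annihilator of `z` in `U(𝔤₋)` and
`σ` is the automorphism of `U(𝔤)` that interchanges `e_α` and `f_α`. As `σ` sends `p(f)` to
`p(e)` for each non-commutative polynomial `p`, the ideal `σ(I⁻)` consists of the `p(e)` with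
`p(f) ∈ I⁻`. -/
def idealPlus {Z : Type*} [AddCommGroup Z] [Module ℂ Z]
    [Module (UniversalEnvelopingAlgebra ℂ 𝔤) Z]
    [IsScalarTower ℂ (UniversalEnvelopingAlgebra ℂ 𝔤) Z] (z : Z) : Ideal (gen (e b)) :=
  ((annMinus (f b) z).comap (evalGen (f b))).map (evalGen (e b))

/-- The kernel in `V` of the left ideal `I⁺ = σ(I⁻)`, `I⁻` the annihilator of `z` in `U(𝔤₋)`.
For the highest vector `z` of `Z` this is the extremal subspace `V⁺_Z`. -/
def extremal (V : Type*) [AddCommGroup V] [Module ℂ V]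
    [Module (UniversalEnvelopingAlgebra ℂ 𝔤) V]
    [IsScalarTower ℂ (UniversalEnvelopingAlgebra ℂ 𝔤) V] {Z : Type*} [AddCommGroup Z] [Module ℂ Z]
    [Module (UniversalEnvelopingAlgebra ℂ 𝔤) Z]
    [IsScalarTower ℂ (UniversalEnvelopingAlgebra ℂ 𝔤) Z] (z : Z) : Submodule ℂ V :=
  idealKer (idealPlus b z) V

/-- The space `(V ⊗ Z)⁺` spanned by the singular vectors. -/
def singular (V Z : Type*) [AddCommGroup V] [Module ℂ V]
    [Module (UniversalEnvelopingAlgebra ℂ 𝔤) V]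
    [IsScalarTower ℂ (UniversalEnvelopingAlgebra ℂ 𝔤) V] [AddCommGroup Z] [Module ℂ Z]
    [Module (UniversalEnvelopingAlgebra ℂ 𝔤) Z]
    [IsScalarTower ℂ (UniversalEnvelopingAlgebra ℂ 𝔤) Z] : Submodule ℂ (V ⊗[ℂ] Z) :=
  singularSpan V Z (fun h : H => comul (h : 𝔤)) (fun i => comul (b.e i))
    (fun (μ : Module.Dual ℂ H) (h : H) => μ h)

end Classical

end Classical

end Extremal

end

noncomputable section

namespace Extremal

/-! Multiplying `Δ(e_α) = e_α ⊗ q^{h_α} + 1 ⊗ e_α` by the invertible element `1 ⊗ q^{-h_α}` turns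
`Δ(e_α) u = 0` into `(e_α ⊗ 1) u = (1 ⊗ x_α) u` with `x_α = -q^{-h_α} e_α`; classically `x_α =
-e_α`. As `V ⊗ Z` is a sum of weight spaces and the common kernel of the `Δ(e_α)` is stable under
the Cartan part, `(V ⊗ Z)⁺` is the whole solution space of this system (`mem_singularSpan_iff`).

On `Z` the operators `x_α` and `f_α` are adjoint for the form `⟨f_a 1_ζ, f_b 1_ζ⟩ = *1_ζ(x_{rev a}
f_b 1_ζ)`, where `a`, `b` are words. It is symmetric (`dual_symm`), it is non-degenerate because `Z`
is irreducible (`eq_zero_of_dual_word`), and words of different lengths are orthogonal. Pairing the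
second factor of `u` with this form gives a linear map `T : Z → V`, and the system says `T f_α = e_α
T`. Hence `T(f_a 1_ζ) = e_a w`, where `w = T(1_ζ)` is the leading coefficient, so `u` is determined
by `w`. A map `T` with these values exists exactly when each relation `∑ c_a f_a 1_ζ = 0` implies `∑
c_a e_a w = 0`, which is the condition `w ∈ V⁺_Z`. Such a `T` kills all long words, since long words
in the `e_α` kill `w`, and it therefore comes from a tensor (`exists_tensor`). This is
`exists_leadingLeft_equiv`.

For the other leading coefficient the two factors are exchanged. The same argument on `V`, with
`e_α` and `f_α` as the adjoint pair, yields the kernel in `Z` of the relations of `1_ν` written in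
the `x_α` instead of the `e_α`. A word in the `x_α` is the same word in the `e_α` followed by an
invertible operator that depends only on the content of the word (`word_ke`, `twist_perm`), and the
relations are homogeneous (`sum_perm_eq_zero`), so the kernel is the same (`wordEval_twist`).

`IsHighestWeightSystem` collects what the argument needs in both cases. That `q` is not a root of
unity enters only through its field `perm`: the weight of `f_a 1_ν` determines the content of `a`,
because the numbers `(α_i, α_j)` are rational and the form is non-degenerate. -/

/-! ### Words in families of operators -/

section Word

variable {ι R : Type*} [Monoid R]

/-- The product of the elements `x i` along a word. -/
def word (x : ι → R) (a : List ι) : R := (a.map x).prod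

@[simp] theorem word_nil (x : ι → R) : word x [] = 1 := rfl

@[simp] theorem word_cons (x : ι → R) (i : ι) (a : List ι) : word x (i :: a) = x i * word x a := by
  simp [word]

@[simp] theorem word_append (x : ι → R) (a b : List ι) :
    word x (a ++ b) = word x a * word x b := by
  simp [word]

theorem map_word {S F : Type*} [Monoid S] [FunLike F R S] [MonoidHomClass F R S] (φ : F)
    (x : ι → R) (a : List ι) : φ (word x a) = word (fun i => φ (x i)) a := by
  simp [word, map_list_prod, Function.comp_def]

end Word

/-! ### Leading coefficients -/

section Leading

variable {V Z : Type*} [AddCommGroup V] [Module ℂ V] [AddCommGroup Z] [Module ℂ Z]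

@[simp] theorem leadingLeft_tmul (ψ : Module.Dual ℂ Z) (v : V) (z : Z) :
    leadingLeft V ψ (v ⊗ₜ z) = ψ z • v := by
  simp [leadingLeft]

@[simp] theorem leadingRight_tmul (φ : Module.Dual ℂ V) (v : V) (z : Z) :
    leadingRight Z φ (v ⊗ₜ z) = φ v • z := by
  simp [leadingRight]

theorem leadingLeft_lTensor (ψ : Module.Dual ℂ Z) (X : Module.End ℂ Z) (u : V ⊗[ℂ] Z) :
    leadingLeft V ψ (X.lTensor V u) = leadingLeft V (ψ ∘ₗ X) u := by
  induction u with
  | zero => simp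
  | tmul v z => simp
  | add a b ha hb => simp only [map_add, ha, hb]

theorem leadingLeft_rTensor (ψ : Module.Dual ℂ Z) (E : Module.End ℂ V) (u : V ⊗[ℂ] Z) :
    leadingLeft V ψ (E.rTensor Z u) = E (leadingLeft V ψ u) := by
  induction u with
  | zero => simp
  | tmul v z => simp
  | add a b ha hb => simp only [map_add, ha, hb]

theorem leadingLeft_comm (φ : Module.Dual ℂ V) (u : V ⊗[ℂ] Z) :
    leadingLeft Z φ (TensorProduct.comm ℂ V Z u) = leadingRight Z φ u := by
  induction u with
  | zero => simp
  | tmul v z => simp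
  | add a b ha hb => simp only [map_add, ha, hb]

/-- A family of functionals that separates the points of `Z` separates those of `V ⊗ Z`. -/
theorem eq_zero_of_leadingLeft {κ : Type*} (Ψ : κ → Module.Dual ℂ Z)
    (hΨ : ∀ w, (∀ a, Ψ a w = 0) → w = 0) (u : V ⊗[ℂ] Z) (hu : ∀ a, leadingLeft V (Ψ a) u = 0) :
    u = 0 := by
  let B := Module.Free.chooseBasis ℂ V
  have key : ∀ (a : κ) (u : V ⊗[ℂ] Z) i,
      Ψ a (TensorProduct.equivFinsuppOfBasisLeft B u i) = B.repr (leadingLeft V (Ψ a) u) i := by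
    intro a u i
    induction u with
    | zero => simp
    | tmul v z => simp [mul_comm]
    | add a b ha hb => simp only [map_add, Finsupp.add_apply, ha, hb]
  apply (TensorProduct.equivFinsuppOfBasisLeft (N := Z) B).injective
  rw [map_zero]
  ext i
  exact hΨ _ fun a => by rw [key, hu]; simp

end Leading

/-! ### Contragredient pairs of operator families -/

section Core

variable {ι V Z : Type*} [AddCommGroup V] [Module ℂ V] [AddCommGroup Z] [Module ℂ Z]

/-- The families `x`, `y` of operators on `Z` are adjoint to each other with respect to a
non-degenerate symmetric form `⟨y_a z, y_b z⟩ = ψ (x_{rev a} y_b z)` that is compatible with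
the grading of words by length. -/
structure IsContragredientPair (x y : ι → Module.End ℂ Z) (z : Z) (ψ : Module.Dual ℂ Z) :
    Prop where
  span : Submodule.span ℂ (Set.range fun a => word y a z) = ⊤
  symm : ∀ a b, ψ (word x a.reverse (word y b z)) = ψ (word x b.reverse (word y a z))
  orth : ∀ a b : List ι, a.length ≠ b.length → ψ (word x a (word y b z)) = 0
  nondeg : ∀ w, (∀ a, ψ (word x a w) = 0) → w = 0

/-- The combination `∑ c_a y_a z` of the vectors obtained from `z` by words in `y`. -/
def wordEval (y : ι → Module.End ℂ Z) (z : Z) : (List ι →₀ ℂ) →ₗ[ℂ] Z :=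
  Finsupp.linearCombination ℂ fun a => word y a z

@[simp] theorem wordEval_single (y : ι → Module.End ℂ Z) (z : Z) (a : List ι) (r : ℂ) :
    wordEval y z (Finsupp.single a r) = r • word y a z := by
  simp [wordEval]

/-- A surjection of vector spaces splits. Applied to `wordEval`, this defines linear maps by
prescribing values on words, subject to the relations among them. -/
theorem exists_factor {M N P : Type*} [AddCommGroup M] [Module ℂ M] [AddCommGroup N] [Module ℂ N]
    [AddCommGroup P] [Module ℂ P] (F : M →ₗ[ℂ] N) (hF : Function.Surjective F) (G : M →ₗ[ℂ] P)
    (h : ∀ m, F m = 0 → G m = 0) : ∃ T : N →ₗ[ℂ] P, ∀ m, T (F m) = G m := by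
  obtain ⟨s, hs⟩ := F.exists_rightInverse_of_surjective (LinearMap.range_eq_top.2 hF)
  refine ⟨G ∘ₗ s, fun m => ?_⟩
  have h1 : F (s (F m) - m) = 0 := by
    rw [map_sub, sub_eq_zero]
    exact LinearMap.congr_fun hs (F m)
  simpa [sub_eq_zero] using h _ h1

namespace IsContragredientPair

variable {x y : ι → Module.End ℂ Z} {z : Z} {ψ : Module.Dual ℂ Z}

theorem wordEval_surjective (h : IsContragredientPair x y z ψ) :
    Function.Surjective (wordEval y z) := by
  rw [← LinearMap.range_eq_top, wordEval, Finsupp.range_linearCombination, h.span]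

theorem ext_word {P : Type*} [AddCommGroup P] [Module ℂ P] (h : IsContragredientPair x y z ψ)
    {S T : Z →ₗ[ℂ] P} (hST : ∀ a, S (word y a z) = T (word y a z)) : S = T :=
  LinearMap.ext_on_range h.span hST

/-- Well defined by symmetry: if `∑ c_a y_a z = 0`, then the value of `∑ c_a ψ ∘ x_{rev a}` on `y_b
z` equals `ψ (x_{rev b} (∑ c_a y_a z)) = 0`. -/
theorem exists_form (h : IsContragredientPair x y z ψ) :
    ∃ B : Z →ₗ[ℂ] Module.Dual ℂ Z, ∀ a, B (word y a z) = ψ ∘ₗ word x a.reverse := by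
  obtain ⟨B, hB⟩ := exists_factor (wordEval y z) h.wordEval_surjective
    (Finsupp.linearCombination ℂ fun a : List ι => ψ ∘ₗ word x a.reverse) (by
      intro c hc
      refine h.ext_word fun b => ?_
      have h1 : ψ (word x b.reverse (wordEval y z c)) = 0 := by rw [hc, map_zero, map_zero]
      rw [LinearMap.zero_apply, ← h1]
      simp only [wordEval, Finsupp.linearCombination_apply, Finsupp.sum, map_sum, map_smul,
        LinearMap.sum_apply, LinearMap.smul_apply, LinearMap.comp_apply]
      exact Finset.sum_congr rfl fun a _ => by rw [h.symm])
  refine ⟨B, fun a => ?_⟩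
  simpa using hB (Finsupp.single a 1)

theorem form_symm (h : IsContragredientPair x y z ψ) {B : Z →ₗ[ℂ] Module.Dual ℂ Z}
    (hB : ∀ a, B (word y a z) = ψ ∘ₗ word x a.reverse) (w w' : Z) : B w w' = B w' w := by
  have : B = B.flip := by
    refine h.ext_word fun a => h.ext_word fun b => ?_
    rw [LinearMap.flip_apply, hB, hB]
    exact h.symm a b
  conv_lhs => rw [this]
  rfl

theorem form_injective (h : IsContragredientPair x y z ψ) {B : Z →ₗ[ℂ] Module.Dual ℂ Z}
    (hB : ∀ a, B (word y a z) = ψ ∘ₗ word x a.reverse) (w : Z)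
    (hw : ∀ a, B w (word y a z) = 0) : w = 0 := by
  refine h.nondeg w fun a => ?_
  have := hw a.reverse
  rw [h.form_symm hB, hB, List.reverse_reverse] at this
  exact this

/-- Each `1 ⊗ x_i` is traded for `E_i ⊗ 1`. The latter commutes with what still acts on the second
factor, so the letters end up in the opposite order. -/
theorem leadingLeft_word {E : ι → Module.End ℂ V} {u : V ⊗[ℂ] Z}
    (hu : ∀ i, (E i).rTensor Z u = (x i).lTensor V u) (a : List ι) :
    leadingLeft V (ψ ∘ₗ word x a) u = word E a.reverse (leadingLeft V ψ u) := by
  suffices H : (word x a).lTensor V u = (word E a.reverse).rTensor Z u by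
    rw [← leadingLeft_lTensor, H, leadingLeft_rTensor]
  induction a with
  | nil => simp [Module.End.one_eq_id]
  | cons i a ih =>
    have hc : ∀ u' : V ⊗[ℂ] Z, (x i).lTensor V ((word E a.reverse).rTensor Z u')
        = (word E a.reverse).rTensor Z ((x i).lTensor V u') := fun u' =>
      LinearMap.congr_fun ((LinearMap.lTensor_comp_rTensor ..).trans
        (LinearMap.rTensor_comp_lTensor ..).symm) u'
    rw [word_cons, LinearMap.lTensor_mul, Module.End.mul_apply, ih, hc, ← hu, List.reverse_cons,
      word_append, LinearMap.rTensor_mul, Module.End.mul_apply]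
    simp

/-- The span `W` of the words of length at most `N` is finite-dimensional and orthogonal to all
longer words, so the form stays non-degenerate on `W`. The tensor is the canonical element `∑ T(w_j)
⊗ w'_j` for dual bases of `W`. -/
theorem exists_tensor [Finite ι] (h : IsContragredientPair x y z ψ) (T : Z →ₗ[ℂ] V) (N : ℕ)
    (hT : ∀ a : List ι, N ≤ a.length → T (word y a z) = 0) :
    ∃ u : V ⊗[ℂ] Z, ∀ a : List ι, leadingLeft V (ψ ∘ₗ word x a.reverse) u = T (word y a z) := by
  obtain ⟨B, hB⟩ := h.exists_form
  let S : Set (List ι) := {a | a.length ≤ N}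
  let W : Submodule ℂ Z := Submodule.span ℂ ((fun a => word y a z) '' S)
  have hfin : FiniteDimensional ℂ W :=
    FiniteDimensional.span_of_finite ℂ ((List.finite_length_le ι N).image _)
  have horth : ∀ a b : List ι, a.length ≠ b.length → B (word y a z) (word y b z) = 0 := by
    intro a b hab
    rw [hB]
    exact h.orth _ _ (by simpa using hab)
  have hWbig : ∀ a : List ι, N < a.length → ∀ w ∈ W, B (word y a z) w = 0 := by
    intro a ha w hw
    have : W ≤ LinearMap.ker (B (word y a z)) := Submodule.span_le.2 (by
      rintro _ ⟨b, hb, rfl⟩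
      exact horth a b (lt_of_le_of_lt hb ha).ne')
    exact this hw
  let BW : W →ₗ[ℂ] Module.Dual ℂ W := (B.domRestrict₁₂ W W)
  have hBW : ∀ w w' : W, BW w w' = B w w' := fun _ _ => rfl
  -- A vector of the radical of `W` is orthogonal to short words by assumption and to long ones by
  -- length, hence to all of `Z`.
  have hinj : Function.Injective BW := by
    rw [← LinearMap.ker_eq_bot, LinearMap.ker_eq_bot']
    intro w hw
    apply Subtype.ext
    refine h.form_injective hB _ fun a => ?_
    by_cases ha : a.length ≤ N
    · have h1 : word y a z ∈ W := Submodule.subset_span ⟨a, ha, rfl⟩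
      have := LinearMap.congr_fun hw ⟨_, h1⟩
      exact this
    · rw [h.form_symm hB]
      exact hWbig a (not_le.1 ha) _ w.2
  let e : W ≃ₗ[ℂ] Module.Dual ℂ W :=
    LinearEquiv.ofInjectiveOfFinrankEq BW hinj (Subspace.dual_finrank_eq).symm
  have he : ∀ w, e w = BW w := fun _ => rfl
  let w := Module.finBasis ℂ W
  let w' := fun j => e.symm (w.coord j)
  have hw' : ∀ (m : W) j, B m (w' j) = w.repr m j := by
    intro m j
    rw [h.form_symm hB, ← hBW, ← he]
    simp [w']
  refine ⟨∑ j, T (w j) ⊗ₜ (w' j : Z), fun a => ?_⟩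
  have hsum : leadingLeft V (B (word y a z)) (∑ j, T (w j) ⊗ₜ (w' j : Z)) = T (word y a z) := by
    simp only [map_sum, leadingLeft_tmul]
    by_cases ha : a.length ≤ N
    · have h1 : word y a z ∈ W := Submodule.subset_span ⟨a, ha, rfl⟩
      have h2 := congrArg (fun m : W => T m) (w.sum_repr ⟨_, h1⟩)
      simp only [Submodule.coe_sum, Submodule.coe_smul, map_sum, map_smul] at h2
      rw [← h2]
      exact Finset.sum_congr rfl fun j _ => by rw [← hw' ⟨_, h1⟩]
    · rw [hT a (not_le.1 ha).le]
      exact Finset.sum_eq_zero fun j _ => by rw [hWbig a (not_le.1 ha) _ (w' j).2, zero_smul]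
  rw [← hB, hsum]

/-- Taking leading coefficients is an isomorphism from the space of solutions of
`(E_i ⊗ 1) u = (1 ⊗ x_i) u` onto the space of those `w` that `∑ c_a E_a` kills whenever
`∑ c_a y_a` kills `z`. -/
theorem exists_leadingLeft_equiv [Finite ι] (h : IsContragredientPair x y z ψ)
    {E : ι → Module.End ℂ V} (hE : ∀ w : V, ∃ N, ∀ a : List ι, N ≤ a.length → word E a w = 0)
    {S : Submodule ℂ (V ⊗[ℂ] Z)} (hS : ∀ u, u ∈ S ↔ ∀ i, (E i).rTensor Z u = (x i).lTensor V u)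
    {P : Submodule ℂ V} (hP : ∀ w, w ∈ P ↔ ∀ c, wordEval y z c = 0 → wordEval E w c = 0) :
    ∃ Φ : S ≃ₗ[ℂ] P, ∀ u : S, (Φ u : V) = leadingLeft V ψ (u : V ⊗[ℂ] Z) := by
  have hsep := eq_zero_of_leadingLeft (V := V) (fun a : List ι => ψ ∘ₗ word x a)
    (fun w hw => h.nondeg w hw)
  have hmem : ∀ u ∈ S, leadingLeft V ψ u ∈ P := by
    intro u hu
    rw [hS] at hu
    rw [hP]
    intro c hc
    -- `∑ c_a E_a` applied to the leading coefficient is the contraction of `u` with the functional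
    -- `B (∑ c_a y_a z)`, which is zero for a relation.
    obtain ⟨B, hB⟩ := h.exists_form
    have h1 : ∀ c, wordEval E (leadingLeft V ψ u) c = leadingLeft V (B (wordEval y z c)) u := by
      intro c
      induction c using Finsupp.induction_linear with
      | zero => simp [leadingLeft]
      | add f g hf hg =>
        rw [map_add, hf, hg, map_add, map_add]
        simp only [leadingLeft, LinearMap.lTensor_add, LinearMap.comp_apply,
          LinearMap.add_apply, map_add]
      | single a r =>
        simp only [wordEval_single, map_smul, hB, leadingLeft, LinearMap.lTensor_smul,
          LinearMap.comp_apply, LinearMap.smul_apply]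
        congr 1
        have := leadingLeft_word (ψ := ψ) hu a.reverse
        rw [List.reverse_reverse] at this
        exact this.symm
    rw [h1, hc, map_zero]
    simp [leadingLeft]
  let F : S →ₗ[ℂ] P := ((leadingLeft V ψ).domRestrict S).codRestrict P fun u => hmem u u.2
  have hF : ∀ u : S, (F u : V) = leadingLeft V ψ (u : V ⊗[ℂ] Z) := fun _ => rfl
  refine ⟨LinearEquiv.ofBijective F ⟨?_, ?_⟩, fun u => hF u⟩
  -- All contractions of `u` with the separating functionals `ψ ∘ x_a` are words in `E` applied to
  -- the leading coefficient.
  · rw [← LinearMap.ker_eq_bot, LinearMap.ker_eq_bot']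
    intro u hu
    apply Subtype.ext
    refine hsep _ fun a => ?_
    rw [leadingLeft_word ((hS _).1 u.2), ← hF, hu]
    simp
  · intro w
    obtain ⟨T, hT⟩ := exists_factor (wordEval y z) h.wordEval_surjective (wordEval E (w : V))
      ((hP _).1 w.2)
    have hT' : ∀ a, T (word y a z) = word E a (w : V) := fun a => by
      simpa using hT (Finsupp.single a 1)
    obtain ⟨N, hN⟩ := hE w
    obtain ⟨u, hu⟩ := h.exists_tensor T N fun a ha => by rw [hT', hN a ha]
    have hu' : ∀ a, leadingLeft V (ψ ∘ₗ word x a) u = word E a.reverse (w : V) := fun a => by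
      rw [← hT', ← hu, List.reverse_reverse]
    have huS : u ∈ S := by
      rw [hS]
      intro i
      rw [← sub_eq_zero]
      refine hsep _ fun a => ?_
      -- Both sides of the equation contract with `ψ ∘ x_a` to `E_i E_{rev a} w`, as the reverse of
      -- `a ++ [i]` starts with `i`.
      have h1 := hu' (a ++ [i])
      rw [map_sub, leadingLeft_rTensor, leadingLeft_lTensor, hu', LinearMap.comp_assoc]
      simp only [word_append, word_cons, word_nil, mul_one, Module.End.mul_eq_comp,
        List.reverse_append, List.reverse_cons, List.reverse_nil, List.nil_append,
        List.singleton_append] at h1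
      rw [h1]
      simp
    refine ⟨⟨u, huS⟩, Subtype.ext ?_⟩
    rw [hF]
    simpa [Module.End.one_eq_id] using hu' []

end IsContragredientPair

end Core

/-! ### Simultaneous eigenspaces -/

section Eigen

variable {τ M : Type*} [AddCommGroup M] [Module ℂ M]

/-- The simultaneous eigenspace of a family of operators. -/
def eigen (t : τ → Module.End ℂ M) (χ : τ → ℂ) : Submodule ℂ M where
  carrier := {w | ∀ s, t s w = χ s • w}
  zero_mem' := fun s => by simp
  add_mem' := fun hv hw s => by rw [map_add, hv s, hw s, smul_add]
  smul_mem' := fun a v hv s => by rw [map_smul, hv s, smul_comm]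

theorem mem_eigen {t : τ → Module.End ℂ M} {χ : τ → ℂ} {w : M} :
    w ∈ eigen t χ ↔ ∀ s, t s w = χ s • w := Iff.rfl

/-- A subspace stable under a family of operators contains the components of its elements in the
simultaneous eigenspaces. -/
theorem mem_of_sum_eigen_mem (t : τ → Module.End ℂ M) {P : Submodule ℂ M}
    (hP : ∀ s, ∀ w ∈ P, t s w ∈ P) (S : Finset (τ → ℂ)) :
    ∀ u : (τ → ℂ) → M, (∀ χ ∈ S, u χ ∈ eigen t χ) → ∑ χ ∈ S, u χ ∈ P → ∀ χ ∈ S, u χ ∈ P := by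
  classical
  induction S using Finset.induction_on with
  | empty => simp
  | insert χ₀ S hχ₀ ih =>
    intro u hu hsum
    have hS : ∀ χ ∈ S, u χ ∈ P := by
      intro χ hχ
      have hne : χ ≠ χ₀ := fun h => hχ₀ (h ▸ hχ)
      obtain ⟨s, hs⟩ := Function.ne_iff.1 hne
      -- The operator `t s - χ₀ s` removes the `χ₀`-component and multiplies the `χ`-component by a
      -- non-zero scalar.
      have h1 : t s (∑ χ ∈ insert χ₀ S, u χ) - χ₀ s • ∑ χ ∈ insert χ₀ S, u χ
          = ∑ χ ∈ S, (χ s - χ₀ s) • u χ := by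
        rw [Finset.sum_insert hχ₀, map_add, smul_add, hu χ₀ (Finset.mem_insert_self _ _) s,
          add_sub_add_left_eq_sub, map_sum, Finset.smul_sum, ← Finset.sum_sub_distrib]
        exact Finset.sum_congr rfl fun χ hχ => by
          rw [hu χ (Finset.mem_insert_of_mem hχ) s, sub_smul]
      have h2 := ih (fun χ => (χ s - χ₀ s) • u χ)
        (fun χ hχ => Submodule.smul_mem _ _ (hu χ (Finset.mem_insert_of_mem hχ)))
        (h1 ▸ P.sub_mem (hP s _ hsum) (P.smul_mem _ hsum)) χ hχ
      exact (P.smul_mem_iff (sub_ne_zero.2 hs)).1 h2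
    intro χ hχ
    rcases Finset.mem_insert.1 hχ with rfl | hχ
    · rw [Finset.sum_insert hχ₀] at hsum
      exact (P.add_mem_iff_left (P.sum_mem hS)).1 hsum
    · exact hS χ hχ

/-- If the whole space is spanned by eigenvectors, then so is every stable subspace. -/
theorem le_span_eigen_of_stable {W : Type*} (t : τ → Module.End ℂ M) (ev : W → τ → ℂ)
    (htop : ⨆ μ, eigen t (ev μ) = ⊤) {P : Submodule ℂ M} (hP : ∀ s, ∀ w ∈ P, t s w ∈ P) :
    P ≤ Submodule.span ℂ {u | u ≠ 0 ∧ (∃ μ, u ∈ eigen t (ev μ)) ∧ u ∈ P} := by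
  classical
  intro w hw
  -- Different `μ` may have the same eigenvalues, as for complex powers of `q`, so the components
  -- are indexed by eigenvalue systems.
  have hw' : w ∈ ⨆ χ : Set.range ev, eigen t χ := by
    have : ⨆ μ, eigen t (ev μ) ≤ ⨆ χ : Set.range ev, eigen t χ :=
      iSup_le fun μ => le_iSup (fun χ : Set.range ev => eigen t χ) ⟨ev μ, μ, rfl⟩
    exact this (htop ▸ Submodule.mem_top)
  obtain ⟨c, hc, hsum⟩ := (Submodule.mem_iSup_iff_exists_finsupp _ _).1 hw'
  let u : (τ → ℂ) → M := fun χ => if h : χ ∈ Set.range ev then c ⟨χ, h⟩ else 0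
  have hu : ∀ χ : Set.range ev, u χ = c χ := fun χ => dif_pos χ.2
  let S : Finset (τ → ℂ) := c.support.map (Function.Embedding.subtype _)
  have hS : ∑ χ ∈ S, u χ = w := by
    rw [Finset.sum_map, ← hsum]
    exact Finset.sum_congr rfl fun χ _ => hu χ
  have key := mem_of_sum_eigen_mem t hP S u (by
    intro χ hχ
    obtain ⟨χ', -, rfl⟩ := Finset.mem_map.1 hχ
    exact (hu χ').symm ▸ hc χ') (hS.symm ▸ hw)
  rw [← hS]
  refine Submodule.sum_mem _ fun χ hχ => ?_
  by_cases h0 : u χ = 0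
  · rw [h0]; exact Submodule.zero_mem _
  · refine Submodule.subset_span ⟨h0, ?_, key χ hχ⟩
    obtain ⟨⟨_, μ, rfl⟩, -, rfl⟩ := Finset.mem_map.1 hχ
    refine ⟨μ, ?_⟩
    have h1 := hc ⟨ev μ, μ, rfl⟩
    rw [← hu] at h1
    exact h1

end Eigen

/-! ### Words acting on a highest vector -/

section Words

variable {ι M : Type*} [AddCommGroup M] [Module ℂ M]

theorem word_eigen {τ Λ : Type*} [AddCommGroup Λ] {α : ι → Λ} {ev : Λ → τ → ℂ}
    {y : ι → Module.End ℂ M} {t : τ → Module.End ℂ M}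
    (hy : ∀ i μ, ∀ w ∈ eigen t (ev μ), y i w ∈ eigen t (ev (μ - α i))) {μ : Λ} {m : M}
    (hm : m ∈ eigen t (ev μ)) (a : List ι) :
    word y a m ∈ eigen t (ev (μ - (a.map α).sum)) := by
  induction a with
  | nil => simpa using hm
  | cons i a ih =>
    have := hy i _ _ ih
    rwa [sub_sub, add_comm, ← List.sum_cons, ← List.map_cons] at this

theorem word_dualMap (x : ι → Module.End ℂ M) (a : List ι) (φ : Module.Dual ℂ M) :
    word (fun i => (x i).dualMap) a φ = φ ∘ₗ word x a.reverse := by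
  induction a with
  | nil => rfl
  | cons i a ih =>
    rw [word_cons, Module.End.mul_apply, ih, List.reverse_cons, word_append]
    simp [LinearMap.dualMap_apply', LinearMap.comp_assoc, Module.End.mul_eq_comp]

/-- The span of the vectors obtained from `m` by words of length `n`. -/
def lengthSpan (y : ι → Module.End ℂ M) (m : M) (n : ℕ) : Submodule ℂ M :=
  Submodule.span ℂ ((fun a => word y a m) '' {a | a.length = n})

theorem word_mem_lengthSpan (y : ι → Module.End ℂ M) (m : M) (a : List ι) :
    word y a m ∈ lengthSpan y m a.length := Submodule.subset_span ⟨a, rfl, rfl⟩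

theorem lengthSpan_le_span (y : ι → Module.End ℂ M) (m : M) (n : ℕ) :
    lengthSpan y m n ≤ Submodule.span ℂ (Set.range fun a => word y a m) :=
  Submodule.span_mono (by rintro _ ⟨a, -, rfl⟩; exact ⟨a, rfl⟩)

theorem apply_mem_lengthSpan (y : ι → Module.End ℂ M) (m : M) (i : ι) {n : ℕ} {w : M}
    (hw : w ∈ lengthSpan y m n) : y i w ∈ lengthSpan y m (n + 1) := by
  have : lengthSpan y m n ≤ (lengthSpan y m (n + 1)).comap (y i) := Submodule.span_le.2 (by
    rintro _ ⟨a, rfl, rfl⟩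
    exact word_mem_lengthSpan y m (i :: a))
  exact this hw

/-- A family `x` that kills `m` and commutes with the family `y` up to scalars and diagonal
terms. -/
structure IsLowering (x y : ι → Module.End ℂ M) (m : M) (q : ι → ι → ℂ) (γ : ι → List ι → ℂ) :
    Prop where
  apply_eq_zero : ∀ i, x i m = 0
  comm_ne : ∀ i j, i ≠ j → ∀ w, x i (y j w) = q i j • y j (x i w)
  comm_self : ∀ i a, x i (y i (word y a m)) = q i i • y i (x i (word y a m)) + γ i a • word y a m

namespace IsLowering

variable {x y : ι → Module.End ℂ M} {m : M} {q : ι → ι → ℂ} {γ : ι → List ι → ℂ}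

/-- Moving `x i` to the right until it meets `m` deletes one letter from the word in each surviving
term. -/
theorem apply_word (h : IsLowering x y m q γ) (i j : ι) (a : List ι) :
    x i (word y (j :: a) m) ∈ lengthSpan y m a.length := by
  induction a generalizing j with
  | nil =>
    by_cases hij : i = j
    · subst hij
      have := h.comm_self i []
      simp only [word_cons, word_nil, mul_one, Module.End.one_apply] at this ⊢
      rw [this, h.apply_eq_zero, map_zero, smul_zero, zero_add]
      exact Submodule.smul_mem _ _ (word_mem_lengthSpan y m [])
    · simp [h.comm_ne i j hij, h.apply_eq_zero]
  | cons k a ih =>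
    have h1 : y j (x i (word y (k :: a) m)) ∈ lengthSpan y m (k :: a).length :=
      apply_mem_lengthSpan y m j (ih k)
    rw [word_cons, Module.End.mul_apply]
    by_cases hij : i = j
    · subst hij
      rw [h.comm_self]
      exact Submodule.add_mem _ (Submodule.smul_mem _ _ h1)
        (Submodule.smul_mem _ _ (word_mem_lengthSpan y m _))
    · rw [h.comm_ne i j hij]
      exact Submodule.smul_mem _ _ h1

theorem apply_lengthSpan_zero (h : IsLowering x y m q γ) (i : ι) {w : M}
    (hw : w ∈ lengthSpan y m 0) : x i w = 0 := by
  have : lengthSpan y m 0 ≤ LinearMap.ker (x i) := Submodule.span_le.2 (by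
    rintro _ ⟨a, ha, rfl⟩
    obtain rfl := List.length_eq_zero_iff.1 ha
    exact h.apply_eq_zero i)
  exact this hw

theorem apply_lengthSpan_succ (h : IsLowering x y m q γ) (i : ι) {n : ℕ} {w : M}
    (hw : w ∈ lengthSpan y m (n + 1)) : x i w ∈ lengthSpan y m n := by
  have : lengthSpan y m (n + 1) ≤ (lengthSpan y m n).comap (x i) := Submodule.span_le.2 (by
    rintro _ ⟨a, ha, rfl⟩
    obtain ⟨j, a, rfl⟩ := List.exists_cons_of_length_eq_add_one ha
    obtain rfl : a.length = n := by simpa using ha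
    exact h.apply_word i j a)
  exact this hw

theorem apply_span (h : IsLowering x y m q γ) (i : ι) {w : M}
    (hw : w ∈ Submodule.span ℂ (Set.range fun a => word y a m)) :
    x i w ∈ Submodule.span ℂ (Set.range fun a => word y a m) := by
  have : Submodule.span ℂ (Set.range fun a => word y a m)
      ≤ (Submodule.span ℂ (Set.range fun a => word y a m)).comap (x i) := Submodule.span_le.2 (by
    rintro _ ⟨a, rfl⟩
    cases a with
    | nil => simp [h.apply_eq_zero]
    | cons j a => exact lengthSpan_le_span _ _ _ (h.apply_word i j a))
  exact this hw

theorem word_apply_span (h : IsLowering x y m q γ) (a : List ι) {w : M}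
    (hw : w ∈ Submodule.span ℂ (Set.range fun a => word y a m)) :
    word x a w ∈ Submodule.span ℂ (Set.range fun a => word y a m) := by
  induction a with
  | nil => exact hw
  | cons i a ih => exact h.apply_span i ih

/-- Each letter of `x` shortens words by one. The induction is on the last letter, which acts first.
-/
theorem word_apply_eq_zero (h : IsLowering x y m q γ) (a : List ι) : ∀ {n : ℕ} {w : M},
    w ∈ lengthSpan y m n → n < a.length → word x a w = 0 := by
  induction a using List.reverseRecOn with
  | nil => simp
  | append_singleton a i ih =>
    intro n w hw hn
    rw [word_append, Module.End.mul_apply, word_cons, word_nil, mul_one]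
    cases n with
    | zero => rw [h.apply_lengthSpan_zero i hw, map_zero]
    | succ n => exact ih (h.apply_lengthSpan_succ i hw) (by simpa using hn)

theorem word_apply_mem (h : IsLowering x y m q γ) (a : List ι) : ∀ {n : ℕ} {w : M},
    w ∈ lengthSpan y m (n + a.length) → word x a w ∈ lengthSpan y m n := by
  induction a using List.reverseRecOn with
  | nil => intro n w hw; exact hw
  | append_singleton a i ih =>
    intro n w hw
    rw [word_append, Module.End.mul_apply, word_cons, word_nil, mul_one]
    refine ih (h.apply_lengthSpan_succ i ?_)
    simpa [add_assoc] using hw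

/-- Local nilpotency of the raising operators. On `V` it makes the intertwining map vanish on long
words, so that it comes from a tensor. -/
theorem exists_word_eq_zero (h : IsLowering x y m q γ)
    (hspan : Submodule.span ℂ (Set.range fun a => word y a m) = ⊤) (w : M) :
    ∃ N, ∀ a : List ι, N ≤ a.length → word x a w = 0 := by
  have hw : w ∈ Submodule.span ℂ (Set.range fun a => word y a m) := hspan ▸ Submodule.mem_top
  induction hw using Submodule.span_induction with
  | mem w hw =>
    obtain ⟨b, rfl⟩ := hw
    exact ⟨b.length + 1, fun a ha => h.word_apply_eq_zero a (word_mem_lengthSpan y m b) ha⟩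
  | zero => exact ⟨0, fun a _ => map_zero _⟩
  | add v w _ _ hv hw =>
    obtain ⟨N, hN⟩ := hv
    obtain ⟨N', hN'⟩ := hw
    exact ⟨max N N', fun a ha => by
      rw [map_add, hN a (le_of_max_le_left ha), hN' a (le_of_max_le_right ha), add_zero]⟩
  | smul r w _ hw =>
    obtain ⟨N, hN⟩ := hw
    exact ⟨N, fun a ha => by rw [map_smul, hN a ha, smul_zero]⟩

end IsLowering

end Words

/-! ### Irreducible highest weight systems -/

section HighestWeight

variable {ι τ Λ M : Type*} [AddCommGroup Λ] [AddCommGroup M] [Module ℂ M]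

/-- Families of raising operators `x`, lowering operators `y`, and diagonal operators `t`, that
act irreducibly on `M` with highest vector `m` of weight `lam`. The weights form the group `Λ`, the
operators `t` have eigenvalues `ev μ` on vectors of weight `μ`, and the operators `y i` and the
transposes of the operators `x i` lower weights by `α i`. -/
structure IsHighestWeightSystem (α : ι → Λ) (ev : Λ → τ → ℂ) (x y g : ι → Module.End ℂ M)
    (t : τ → Module.End ℂ M) (q : ι → ι → ℂ) (G : ι → Λ → ℂ) (lam : Λ) (m : M) : Prop where
  ne_zero : m ≠ 0
  mem_eigen : m ∈ eigen t (ev lam)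
  apply_eq_zero : ∀ i, x i m = 0
  q_symm : ∀ i j, q i j = q j i
  comm_ne : ∀ i j, i ≠ j → ∀ w, x i (y j w) = q i j • y j (x i w)
  comm_self : ∀ i w, x i (y i w) = q i i • y i (x i w) + g i w
  y_mem : ∀ i μ, ∀ w ∈ eigen t (ev μ), y i w ∈ eigen t (ev (μ - α i))
  x_mem : ∀ i μ, ∀ φ ∈ eigen (fun s => (t s).dualMap) (ev μ),
    (x i).dualMap φ ∈ eigen (fun s => (t s).dualMap) (ev (μ - α i))
  g_eigen : ∀ i μ, ∀ w ∈ eigen t (ev μ), g i w = G i μ • w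
  g_dual : ∀ i μ, ∀ φ ∈ eigen (fun s => (t s).dualMap) (ev μ), (g i).dualMap φ = G i μ • φ
  perm : ∀ a b : List ι, ev (lam - (a.map α).sum) = ev (lam - (b.map α).sum) → a.Perm b
  irreducible : ∀ R : Submodule ℂ M, (∀ i, ∀ w ∈ R, x i w ∈ R) → (∀ i, ∀ w ∈ R, y i w ∈ R) →
    (∀ s, ∀ w ∈ R, t s w ∈ R) → R = ⊥ ∨ R = ⊤

namespace IsHighestWeightSystem

variable {α : ι → Λ} {ev : Λ → τ → ℂ} {x y g : ι → Module.End ℂ M}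
  {t : τ → Module.End ℂ M} {q : ι → ι → ℂ} {G : ι → Λ → ℂ} {lam : Λ} {m : M}

theorem word_mem_eigen (h : IsHighestWeightSystem α ev x y g t q G lam m) (a : List ι) :
    word y a m ∈ eigen t (ev (lam - (a.map α).sum)) := word_eigen h.y_mem h.mem_eigen a

theorem isLowering (h : IsHighestWeightSystem α ev x y g t q G lam m) :
    IsLowering x y m q fun i a => G i (lam - (a.map α).sum) where
  apply_eq_zero := h.apply_eq_zero
  comm_ne := h.comm_ne
  comm_self i a := by rw [h.comm_self, h.g_eigen i _ _ (h.word_mem_eigen a)]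

theorem span_eq_top (h : IsHighestWeightSystem α ev x y g t q G lam m) :
    Submodule.span ℂ (Set.range fun a => word y a m) = ⊤ := by
  have hm : m ∈ Submodule.span ℂ (Set.range fun a => word y a m) :=
    Submodule.subset_span ⟨[], rfl⟩
  refine (h.irreducible _ (fun i w hw => h.isLowering.apply_span i hw) ?_ ?_).resolve_left
    fun h0 => h.ne_zero (by rw [h0] at hm; simpa using hm)
  · intro i w hw
    have : Submodule.span ℂ (Set.range fun a => word y a m)
        ≤ (Submodule.span ℂ (Set.range fun a => word y a m)).comap (y i) :=
      Submodule.span_le.2 (by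
        rintro _ ⟨a, rfl⟩
        exact Submodule.subset_span ⟨i :: a, rfl⟩)
    exact this hw
  · intro s w hw
    have : Submodule.span ℂ (Set.range fun a => word y a m)
        ≤ (Submodule.span ℂ (Set.range fun a => word y a m)).comap (t s) :=
      Submodule.span_le.2 (by
        rintro _ ⟨a, rfl⟩
        rw [SetLike.mem_coe, Submodule.mem_comap, h.word_mem_eigen a s]
        exact Submodule.smul_mem _ _ (Submodule.subset_span ⟨a, rfl⟩))
    exact this hw

theorem ext_word {P : Type*} [AddCommGroup P] [Module ℂ P]
    (h : IsHighestWeightSystem α ev x y g t q G lam m)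
    {S T : M →ₗ[ℂ] P} (hST : ∀ a, S (word y a m) = T (word y a m)) : S = T :=
  LinearMap.ext_on_range h.span_eq_top hST

theorem exists_word_eq_zero (h : IsHighestWeightSystem α ev x y g t q G lam m) (w : M) :
    ∃ N, ∀ a : List ι, N ≤ a.length → word x a w = 0 :=
  h.isLowering.exists_word_eq_zero h.span_eq_top w

theorem iSup_eigen (h : IsHighestWeightSystem α ev x y g t q G lam m) :
    ⨆ μ, eigen t (ev μ) = ⊤ := by
  rw [eq_top_iff, ← h.span_eq_top, Submodule.span_le]
  rintro _ ⟨a, rfl⟩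
  exact Submodule.mem_iSup_of_mem _ (h.word_mem_eigen a)

/-- The relations among the vectors obtained from the highest vector by words in `y` are
homogeneous. -/
theorem sum_perm_eq_zero (h : IsHighestWeightSystem α ev x y g t q G lam m) {c : List ι →₀ ℂ}
    (hc : wordEval y m c = 0) (a₀ : List ι) [DecidablePred fun a : List ι => a.Perm a₀] :
    wordEval y m (c.filter fun a => a.Perm a₀) = 0 := by
  classical
  let χ : List ι → τ → ℂ := fun a => ev (lam - (a.map α).sum)
  have hχ : ∀ a, χ a = χ a₀ ↔ a.Perm a₀ := fun a =>
    ⟨h.perm a a₀, fun hp => by simp only [χ, (hp.map α).sum_eq]⟩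
  let u : (τ → ℂ) → M := fun ξ => ∑ a ∈ c.support with χ a = ξ, c a • word y a m
  have hu : wordEval y m (c.filter fun a => a.Perm a₀) = u (χ a₀) := by
    rw [wordEval, Finsupp.linearCombination_apply, Finsupp.sum, Finsupp.support_filter]
    refine Finset.sum_congr ?_ fun a ha => ?_
    · ext a; simp [hχ]
    · rw [Finsupp.filter_apply, if_pos ((hχ a).1 (Finset.mem_filter.1 ha).2)]
  rw [hu]
  have hsum : ∑ ξ ∈ c.support.image χ, u ξ = 0 := by
    rw [← hc, wordEval, Finsupp.linearCombination_apply, Finsupp.sum]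
    exact Finset.sum_fiberwise_of_maps_to (fun a ha => Finset.mem_image_of_mem _ ha) _
  by_cases hmem : χ a₀ ∈ c.support.image χ
  -- With the zero subspace as stable subspace this is the independence of simultaneous eigenspaces.
  · have := mem_of_sum_eigen_mem t (P := ⊥) (by simp) (c.support.image χ) u
      (fun ξ _ => Submodule.sum_mem _ fun a ha =>
        Submodule.smul_mem _ _ ((Finset.mem_filter.1 ha).2 ▸ h.word_mem_eigen a))
      (by rw [hsum]; exact Submodule.zero_mem _) _ hmem
    simpa using this
  · refine Finset.sum_eq_zero fun a ha => absurd ?_ hmem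
    rw [← (Finset.mem_filter.1 ha).2]
    exact Finset.mem_image_of_mem _ (Finset.mem_filter.1 ha).1

/-- The functional reads off the coefficient of the empty word. It is well defined because the
component of a relation at the empty word is `c [] • m = 0` with `m ≠ 0`. -/
theorem exists_dual (h : IsHighestWeightSystem α ev x y g t q G lam m) :
    ∃ ψ : Module.Dual ℂ M, ψ m = 1 ∧ ∀ i w, ψ (y i w) = 0 := by
  classical
  have hsurj : Function.Surjective (wordEval y m) := by
    rw [← LinearMap.range_eq_top, wordEval, Finsupp.range_linearCombination, h.span_eq_top]
  obtain ⟨ψ, hψ⟩ := exists_factor (wordEval y m) hsurj (Finsupp.lapply []) (by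
    intro c hc
    have h1 := h.sum_perm_eq_zero hc []
    have h2 : (c.filter fun a => a.Perm []) = Finsupp.single [] (c []) := by
      ext a
      by_cases ha : a = []
      · simp [ha]
      · rw [Finsupp.filter_apply_neg _ _ (by simpa using ha),
          Finsupp.single_eq_of_ne ha]
    rw [h2, wordEval_single] at h1
    exact (smul_eq_zero.1 h1).resolve_right h.ne_zero)
  have hψ' : ∀ a, ψ (word y a m) = (Finsupp.single a (1 : ℂ)) [] := fun a => by
    rw [← Finsupp.lapply_apply (R := ℂ), ← hψ, wordEval_single, one_smul]
  refine ⟨ψ, by simpa using hψ' [], fun i w => ?_⟩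
  have : ψ ∘ₗ y i = 0 := h.ext_word fun a => by simpa using hψ' (i :: a)
  exact LinearMap.congr_fun this w

/-- A functional of weight `lam` can only be non-zero on vectors with the same eigenvalues, and by
`perm` only the empty word has them. -/
theorem dual_apply_word (h : IsHighestWeightSystem α ev x y g t q G lam m) {ψ : Module.Dual ℂ M}
    (hψ : ψ ∈ eigen (fun s => (t s).dualMap) (ev lam)) {a : List ι} (ha : a ≠ []) :
    ψ (word y a m) = 0 := by
  by_contra hne
  refine ha (List.perm_nil.1 (h.perm a [] ?_))
  funext s
  have h1 := LinearMap.congr_fun (hψ s) (word y a m)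
  rw [LinearMap.dualMap_apply, h.word_mem_eigen a s, map_smul, LinearMap.smul_apply] at h1
  simpa using smul_left_injective ℂ hne h1

theorem dual_apply_y (h : IsHighestWeightSystem α ev x y g t q G lam m) {ψ : Module.Dual ℂ M}
    (hψ : ψ ∈ eigen (fun s => (t s).dualMap) (ev lam)) (i : ι) (w : M) : ψ (y i w) = 0 := by
  have : ψ ∘ₗ y i = 0 := h.ext_word fun a => h.dual_apply_word hψ (List.cons_ne_nil i a)
  exact LinearMap.congr_fun this w

/-- The dual lowest vector exists and is unique. -/
theorem existsUnique_dual (h : IsHighestWeightSystem α ev x y g t q G lam m) :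
    ∃! ψ : Module.Dual ℂ M, ψ m = 1 ∧ ψ ∈ eigen (fun s => (t s).dualMap) (ev lam) := by
  obtain ⟨ψ, h1, h2⟩ := h.exists_dual
  refine ⟨ψ, ⟨h1, fun s => h.ext_word fun a => ?_⟩, fun φ hφ => h.ext_word fun a => ?_⟩
  · rw [LinearMap.dualMap_apply, h.word_mem_eigen a s, map_smul, LinearMap.smul_apply]
    cases a with
    | nil => simp
    | cons i a => simp [h2]
  · cases a with
    | nil => simp [h1, hφ.1]
    | cons i a => rw [h.dual_apply_word hφ.2 (List.cons_ne_nil i a), word_cons,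
        Module.End.mul_apply, h2]

theorem word_dual_mem (h : IsHighestWeightSystem α ev x y g t q G lam m) {ψ : Module.Dual ℂ M}
    (hψ : ψ ∈ eigen (fun s => (t s).dualMap) (ev lam)) (a : List ι) :
    ψ ∘ₗ word x a ∈ eigen (fun s => (t s).dualMap) (ev (lam - (a.reverse.map α).sum)) := by
  have := word_eigen h.x_mem hψ a.reverse
  rwa [word_dualMap, List.reverse_reverse] at this

/-- The common kernel `R` of the functionals `ψ ∘ x_a` is stable under all operators and does not
contain `m`, so it is zero by irreducibility. -/
theorem eq_zero_of_dual_word (h : IsHighestWeightSystem α ev x y g t q G lam m)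
    {ψ : Module.Dual ℂ M} (h1 : ψ m = 1) (hψ : ψ ∈ eigen (fun s => (t s).dualMap) (ev lam))
    (w : M) (hw : ∀ a, ψ (word x a w) = 0) : w = 0 := by
  let R : Submodule ℂ M := ⨅ a, LinearMap.ker (ψ ∘ₗ word x a)
  have hR : ∀ w, w ∈ R ↔ ∀ a, ψ (word x a w) = 0 := fun w => by simp [R]
  have hd : ∀ (a : List ι) s w, ψ (word x a (t s w))
      = ev (lam - (a.reverse.map α).sum) s • ψ (word x a w) := fun a s w =>
    LinearMap.congr_fun (h.word_dual_mem hψ a s) w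
  have hg : ∀ (a : List ι) i w, ψ (word x a (g i w))
      = G i (lam - (a.reverse.map α).sum) • ψ (word x a w) := fun a i w =>
    LinearMap.congr_fun (h.g_dual i _ _ (h.word_dual_mem hψ a)) w
  have hx : ∀ i, ∀ w ∈ R, x i w ∈ R := by
    intro i w hw
    rw [hR] at hw ⊢
    intro a
    simpa using hw (a ++ [i])
  -- The operator `y j` is moved to the left through `x_a` until it meets `ψ`, which satisfies `ψ ∘
  -- y j = 0`; the diagonal terms stay in the kernel.
  have hy : ∀ i, ∀ w ∈ R, y i w ∈ R := by
    intro j w hw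
    rw [hR]
    intro a
    induction a using List.reverseRecOn generalizing w with
    | nil => exact h.dual_apply_y hψ j w
    | append_singleton a i ih =>
      rw [word_append, Module.End.mul_apply, word_cons, word_nil, mul_one]
      by_cases hij : i = j
      · subst hij
        rw [h.comm_self, map_add, map_smul, map_add, map_smul, ih _ (hx i w hw), hg,
          (hR w).1 hw]
        simp
      · rw [h.comm_ne i j hij, map_smul, map_smul, ih _ (hx i w hw), smul_zero]
  have ht : ∀ s, ∀ w ∈ R, t s w ∈ R := by
    intro s w hw
    rw [hR] at hw ⊢
    intro a
    rw [hd, hw, smul_zero]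
  rcases h.irreducible R hx hy ht with h0 | h0
  · have : w ∈ R := (hR w).2 hw
    rw [h0] at this
    simpa using this
  · have : m ∈ R := h0 ▸ Submodule.mem_top
    have h2 := (hR m).1 this []
    simp [h1] at h2

/-- On the sum of `M` and its dual let `x' = (x, yᵀ)` and `y' = (y, xᵀ)`. The submodule generated by
`(m, ψ)` under `y'` is the graph of the would-be form; it is stable under `x'`, and `ψ p.1 = p.2 m`
holds on it. This identity at `x'_{rev a} y'_b (m, ψ)` is the symmetry. -/
theorem dual_symm (h : IsHighestWeightSystem α ev x y g t q G lam m)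
    {ψ : Module.Dual ℂ M} (hψ : ψ ∈ eigen (fun s => (t s).dualMap) (ev lam)) (a b : List ι) :
    ψ (word x a.reverse (word y b m)) = ψ (word x b.reverse (word y a m)) := by
  let x' : ι → Module.End ℂ (M × Module.Dual ℂ M) := fun i => (x i).prodMap (y i).dualMap
  let y' : ι → Module.End ℂ (M × Module.Dual ℂ M) := fun i => (y i).prodMap (x i).dualMap
  have hx' : ∀ (a : List ι) p, word x' a p = (word x a p.1, p.2 ∘ₗ word y a.reverse) := by
    intro a p
    rw [← word_dualMap]
    induction a with
    | nil => rfl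
    | cons i a ih => rw [word_cons, Module.End.mul_apply, ih]; rfl
  have hy' : ∀ (a : List ι) p, word y' a p = (word y a p.1, p.2 ∘ₗ word x a.reverse) := by
    intro a p
    rw [← word_dualMap]
    induction a with
    | nil => rfl
    | cons i a ih => rw [word_cons, Module.End.mul_apply, ih]; rfl
  -- Transposition exchanges `i` and `j`, hence `q_symm`. The diagonal scalars agree in both
  -- components because `y_a m` and `ψ ∘ x_{rev a}` have the same weight.
  have hlow : IsLowering x' y' (m, ψ) q fun i a => G i (lam - (a.map α).sum) :=
    { apply_eq_zero := fun i => Prod.ext (h.apply_eq_zero i)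
        (LinearMap.ext fun w => h.dual_apply_y hψ i w)
      comm_ne := fun i j hij p => Prod.ext (h.comm_ne i j hij p.1) (LinearMap.ext fun w => by
        change p.2 (x j (y i w)) = q i j • p.2 (y i (x j w))
        rw [h.comm_ne j i (Ne.symm hij), map_smul, h.q_symm])
      comm_self := fun i a => by
        rw [hy']
        refine Prod.ext ?_ (LinearMap.ext fun w => ?_)
        · exact h.isLowering.comm_self i a
        · have h2 := LinearMap.congr_fun (h.g_dual i _ _ (h.word_dual_mem hψ a.reverse)) w
          rw [List.reverse_reverse] at h2
          change (ψ ∘ₗ word x a.reverse) (x i (y i w))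
            = q i i • (ψ ∘ₗ word x a.reverse) (y i (x i w)) + _
          rw [h.comm_self, map_add, map_smul]
          exact congrArg _ h2 }
  have key : ∀ p ∈ Submodule.span ℂ (Set.range fun a => word y' a (m, ψ)), ψ p.1 = p.2 m := by
    intro p hp
    have : Submodule.span ℂ (Set.range fun a => word y' a (m, ψ)) ≤ LinearMap.eqLocus
        (ψ ∘ₗ LinearMap.fst ℂ M (Module.Dual ℂ M))
        (LinearMap.applyₗ m ∘ₗ LinearMap.snd ℂ M (Module.Dual ℂ M)) := Submodule.span_le.2 (by
      rintro _ ⟨a, rfl⟩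
      change ψ (word y' a (m, ψ)).1 = (word y' a (m, ψ)).2 m
      rw [hy']
      change ψ (word y a m) = ψ (word x a.reverse m)
      cases a with
      | nil => rfl
      | cons i a =>
        rw [h.dual_apply_word hψ (List.cons_ne_nil i a), List.reverse_cons, word_append,
          Module.End.mul_apply, word_cons, word_nil, mul_one, h.apply_eq_zero, map_zero, map_zero])
    exact this hp
  have h2 := key _ (hlow.word_apply_span a.reverse (Submodule.subset_span ⟨b, rfl⟩))
  simp only [hx', hy', List.reverse_reverse] at h2
  exact h2

theorem isContragredientPair (h : IsHighestWeightSystem α ev x y g t q G lam m)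
    {ψ : Module.Dual ℂ M} (h1 : ψ m = 1) (hψ : ψ ∈ eigen (fun s => (t s).dualMap) (ev lam)) :
    IsContragredientPair x y m ψ where
  span := h.span_eq_top
  symm := h.dual_symm hψ
  nondeg := h.eq_zero_of_dual_word h1 hψ
  orth a b hab := by
    rcases lt_or_gt_of_ne hab with hlt | hlt
    · obtain ⟨n, hn⟩ := Nat.exists_eq_add_of_lt hlt
      have h2 : word x a (word y b m) ∈ lengthSpan y m (n + 1) :=
        h.isLowering.word_apply_mem a (by
          rw [show n + 1 + a.length = b.length by omega]
          exact word_mem_lengthSpan y m b)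
      have h3 : lengthSpan y m (n + 1) ≤ LinearMap.ker ψ := Submodule.span_le.2 (by
        rintro _ ⟨c, hc, rfl⟩
        exact h.dual_apply_word hψ (fun h0 => by simp [h0] at hc))
      exact h3 h2
    · rw [h.isLowering.word_apply_eq_zero a (word_mem_lengthSpan y m b) hlt, map_zero]

end IsHighestWeightSystem

end HighestWeight

/-! ### The isomorphisms for highest weight systems -/

section Twist

variable {ι N : Type*} [AddCommGroup N] [Module ℂ N]

/-- A combination of words is the sum of its homogeneous parts, one for each multiset of letters. -/
theorem wordEval_eq_zero_of_perm {E : ι → Module.End ℂ N} {w : N} {c : List ι →₀ ℂ}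
    [∀ a₀, DecidablePred fun a : List ι => a.Perm a₀]
    (h : ∀ a₀, wordEval E w (c.filter fun a => a.Perm a₀) = 0) : wordEval E w c = 0 := by
  classical
  rw [wordEval, Finsupp.linearCombination_apply, Finsupp.sum,
    ← Finset.sum_fiberwise_of_maps_to (g := fun a : List ι => (a : Multiset ι))
      (t := c.support.image fun a : List ι => (a : Multiset ι))
      (fun a ha => Finset.mem_image_of_mem _ ha)]
  refine Finset.sum_eq_zero fun β hβ => ?_
  obtain ⟨a₀, -, rfl⟩ := Finset.mem_image.1 hβ
  rw [← h a₀, wordEval, Finsupp.linearCombination_apply, Finsupp.sum, Finsupp.support_filter]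
  refine Finset.sum_congr (by ext a; simp [Multiset.coe_eq_coe]) fun a ha => ?_
  rw [Finsupp.filter_apply, if_pos (Finset.mem_filter.1 ha).2]

/-- For homogeneous relations it does not matter if the operators `word E a` are modified by
injective operators that depend only on the content of `a`. -/
theorem wordEval_twist {K : Submodule ℂ (List ι →₀ ℂ)}
    [∀ a₀, DecidablePred fun a : List ι => a.Perm a₀]
    (hK : ∀ c ∈ K, ∀ a₀, (c.filter fun a => a.Perm a₀) ∈ K)
    {E E' : ι → Module.End ℂ N} {D : List ι → Module.End ℂ N}
    (hD : ∀ a, Function.Injective (D a)) (hperm : ∀ a b, a.Perm b → D a = D b)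
    (hE : ∀ a w, word E' a w = D a (word E a w)) (w : N) :
    (∀ c ∈ K, wordEval E w c = 0) ↔ ∀ c ∈ K, wordEval E' w c = 0 := by
  -- On a homogeneous part the factor `D a` is constant and comes out of the sum.
  have key : ∀ (c : List ι →₀ ℂ) a₀, wordEval E' w (c.filter fun a => a.Perm a₀)
      = D a₀ (wordEval E w (c.filter fun a => a.Perm a₀)) := by
    intro c a₀
    simp only [wordEval, Finsupp.linearCombination_apply, Finsupp.sum, map_sum, map_smul]
    refine Finset.sum_congr rfl fun a ha => ?_
    rw [Finsupp.support_filter] at ha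
    rw [hE, hperm a a₀ (Finset.mem_filter.1 ha).2]
  constructor
  · intro h c hc
    exact wordEval_eq_zero_of_perm fun a₀ => by rw [key, h _ (hK c hc a₀), map_zero]
  · intro h c hc
    refine wordEval_eq_zero_of_perm fun a₀ => hD a₀ ?_
    rw [← key, h _ (hK c hc a₀), map_zero]

end Twist

section Isomorphisms

variable {ι τ τ' Λ V Z : Type*} [AddCommGroup Λ] [AddCommGroup V] [Module ℂ V]
  [AddCommGroup Z] [Module ℂ Z] {α : ι → Λ}
  {ev : Λ → τ → ℂ} {ev' : Λ → τ' → ℂ}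
  {eV yV gV : ι → Module.End ℂ V} {tV : τ → Module.End ℂ V} {qV : ι → ι → ℂ} {GV : ι → Λ → ℂ}
  {xZ yZ gZ : ι → Module.End ℂ Z} {tZ : τ' → Module.End ℂ Z} {qZ : ι → ι → ℂ} {GZ : ι → Λ → ℂ}
  {ν ζ : Λ} {v : V} {z : Z} {S : Submodule ℂ (V ⊗[ℂ] Z)}

theorem exists_leadingLeft_equiv_of_systems [Finite ι]
    (hV : IsHighestWeightSystem α ev eV yV gV tV qV GV ν v)
    (hZ : IsHighestWeightSystem α ev' xZ yZ gZ tZ qZ GZ ζ z)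
    (hS : ∀ u, u ∈ S ↔ ∀ i, (eV i).rTensor Z u = (xZ i).lTensor V u)
    {P : Submodule ℂ V} (hP : ∀ w, w ∈ P ↔ ∀ c, wordEval yZ z c = 0 → wordEval eV w c = 0)
    {ψ : Module.Dual ℂ Z} (h1 : ψ z = 1) (hψ : ψ ∈ eigen (fun s => (tZ s).dualMap) (ev' ζ)) :
    ∃ Φ : S ≃ₗ[ℂ] P, ∀ u : S, (Φ u : V) = leadingLeft V ψ (u : V ⊗[ℂ] Z) :=
  (hZ.isContragredientPair h1 hψ).exists_leadingLeft_equiv hV.exists_word_eq_zero hS hP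

/-- The equations that define `S` keep their shape when the factors are exchanged, with `eV` as half
of the adjoint pair and `xZ` as the operators on the target. It remains to pass from `xZ` to `eZ` in
the kernel. -/
theorem exists_leadingRight_equiv_of_systems [Finite ι]
    (hV : IsHighestWeightSystem α ev eV yV gV tV qV GV ν v)
    (hZ : IsHighestWeightSystem α ev' xZ yZ gZ tZ qZ GZ ζ z)
    (hS : ∀ u, u ∈ S ↔ ∀ i, (eV i).rTensor Z u = (xZ i).lTensor V u)
    {eZ : ι → Module.End ℂ Z} {D : List ι → Module.End ℂ Z}
    (hD : ∀ a, Function.Injective (D a)) (hperm : ∀ a b, a.Perm b → D a = D b)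
    (hE : ∀ a w, word xZ a w = D a (word eZ a w))
    {P : Submodule ℂ Z} (hP : ∀ w, w ∈ P ↔ ∀ c, wordEval yV v c = 0 → wordEval eZ w c = 0)
    {φ : Module.Dual ℂ V} (h1 : φ v = 1) (hφ : φ ∈ eigen (fun s => (tV s).dualMap) (ev ν)) :
    ∃ Φ : S ≃ₗ[ℂ] P, ∀ u : S, (Φ u : Z) = leadingRight Z φ (u : V ⊗[ℂ] Z) := by
  classical
  let C := TensorProduct.comm ℂ V Z
  have hleft : ∀ (X : Module.End ℂ V) u, X.lTensor Z (C u) = C (X.rTensor Z u) := fun X u =>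
    LinearMap.congr_fun (LinearMap.lTensor_comp_comm ..) u
  have hright : ∀ (X : Module.End ℂ Z) u, X.rTensor V (C u) = C (X.lTensor V u) := fun X u =>
    LinearMap.congr_fun (LinearMap.rTensor_comp_comm ..) u
  have hS' : ∀ u, u ∈ S.map C.toLinearMap ↔
      ∀ i, (xZ i).rTensor V u = (eV i).lTensor Z u := by
    intro u
    obtain ⟨u, rfl⟩ := C.surjective u
    have : C u ∈ S.map C.toLinearMap ↔ u ∈ S := 
      ⟨fun ⟨_, h, he⟩ => C.injective he ▸ h, fun h => ⟨u, h, rfl⟩⟩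
    rw [this, hS]
    refine forall_congr' fun i => ?_
    rw [hleft, hright, C.injective.eq_iff, eq_comm]
  have hP' : ∀ w, w ∈ P ↔ ∀ c, wordEval yV v c = 0 → wordEval xZ w c = 0 := fun w =>
    (hP w).trans (wordEval_twist (K := LinearMap.ker (wordEval yV v))
      (fun c hc a₀ => hV.sum_perm_eq_zero hc a₀) hD hperm hE w)
  obtain ⟨Φ, hΦ⟩ := (hV.isContragredientPair h1 hφ).exists_leadingLeft_equiv
    hZ.exists_word_eq_zero hS' hP'
  refine ⟨(C.submoduleMap S).trans Φ, fun u => ?_⟩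
  rw [LinearEquiv.trans_apply, hΦ, LinearEquiv.submoduleMap_apply, leadingLeft_comm]

end Isomorphisms

/-! ### Modules over an algebra -/

section Algebra

variable {ι τ W U : Type*} [Ring U] [Algebra ℂ U]
variable {V : Type*} [AddCommGroup V] [Module ℂ V] [Module U V] [IsScalarTower ℂ U V]
variable {Z : Type*} [AddCommGroup Z] [Module ℂ Z] [Module U Z] [IsScalarTower ℂ U Z]

/-- The operators on `V` by which a family of elements of `U` acts. -/
def op (V : Type*) [AddCommGroup V] [Module ℂ V] [Module U V] [IsScalarTower ℂ U V]
    (x : ι → U) (i : ι) : Module.End ℂ V := Algebra.lsmul ℂ ℂ V (x i)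

@[simp] theorem op_apply (x : ι → U) (i : ι) (v : V) : op V x i v = x i • v := rfl

theorem word_op_apply (x : ι → U) (a : List ι) (v : V) : word (op V x) a v = word x a • v :=
  (LinearMap.congr_fun (map_word (Algebra.lsmul ℂ ℂ V) x a) v).symm

/-- The combination `∑ c_a x_a` of words in the elements `x i`. -/
def wordSum (x : ι → U) : (List ι →₀ ℂ) →ₗ[ℂ] U := Finsupp.linearCombination ℂ fun a => word x a

theorem wordSum_smul (x : ι → U) (c : List ι →₀ ℂ) (v : V) :
    wordSum x c • v = wordEval (op V x) v c := by
  simp only [wordSum, wordEval, Finsupp.linearCombination_apply, Finsupp.sum, Finset.sum_smul,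
    smul_assoc, word_op_apply]

theorem map_wordSum {U' : Type*} [Ring U'] [Algebra ℂ U'] (φ : U →ₐ[ℂ] U') (x : ι → U)
    (c : List ι →₀ ℂ) : φ (wordSum x c) = wordSum (fun i => φ (x i)) c := by
  simp only [wordSum, Finsupp.linearCombination_apply, Finsupp.sum, map_sum, map_smul, map_word]

theorem mem_gen_iff {x : ι → U} {u : U} : u ∈ gen x ↔ ∃ c, wordSum x c = u := by
  have : Subalgebra.toSubmodule (gen x) = LinearMap.range (wordSum x) := by
    rw [Algebra.adjoin_eq_span, wordSum, Finsupp.range_linearCombination]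
    congr 1
    ext u
    constructor
    · intro hu
      induction hu using Submonoid.closure_induction with
      | mem u hu => obtain ⟨i, rfl⟩ := hu; exact ⟨[i], by simp⟩
      | one => exact ⟨[], rfl⟩
      | mul u v _ _ hu hv =>
        obtain ⟨a, rfl⟩ := hu
        obtain ⟨b, rfl⟩ := hv
        exact ⟨a ++ b, by simp⟩
    · rintro ⟨a, rfl⟩
      exact list_prod_mem fun u hu => by
        obtain ⟨i, -, rfl⟩ := List.mem_map.1 hu
        exact Submonoid.subset_closure ⟨i, rfl⟩
  rw [← Subalgebra.mem_toSubmodule, this, LinearMap.mem_range]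

theorem mem_annMinus {N : Type*} [AddCommGroup N] [Module U N] {f : ι → U} {z : N} {x : gen f} :
    x ∈ annMinus f z ↔ (x : U) • z = 0 := Ideal.mem_torsionOf_iff _ _

theorem mem_idealKer_iff {A : Subalgebra ℂ U} {I : Ideal A} {v : V} :
    v ∈ idealKer I V ↔ I ≤ Ideal.torsionOf A V v := Iff.rfl

/-- A subspace of a simple module that is stable under generators of the algebra is trivial. -/
theorem eq_bot_or_eq_top_of_stable [IsSimpleModule U V] {s : Set U} (hs : Algebra.adjoin ℂ s = ⊤)
    (R : Submodule ℂ V) (hR : ∀ x ∈ s, ∀ w ∈ R, x • w ∈ R) : R = ⊥ ∨ R = ⊤ := by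
  have hU : ∀ u : U, ∀ w ∈ R, u • w ∈ R := by
    intro u
    have hu : u ∈ Algebra.adjoin ℂ s := hs ▸ Algebra.mem_top
    induction hu using Algebra.adjoin_induction with
    | mem x hx => exact hR x hx
    | algebraMap r => intro w hw; rw [algebraMap_smul]; exact R.smul_mem r hw
    | add x y _ _ hx hy => intro w hw; rw [add_smul]; exact R.add_mem (hx w hw) (hy w hw)
    | mul x y _ _ hx hy => intro w hw; rw [mul_smul]; exact hx _ (hy w hw)
  let R' : Submodule U V := { R with smul_mem' := fun u w hw => hU u w hw }
  have hR' : ∀ w, w ∈ R' ↔ w ∈ R := fun w => Iff.rfl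
  rcases eq_bot_or_eq_top R' with h | h
  · left
    ext w
    rw [← hR', h, Submodule.mem_bot, Submodule.mem_bot]
  · right
    ext w
    rw [← hR', h]
    simp

@[simp] theorem tensorAction_tmul (x y : U) (v : V) (z : Z) :
    tensorAction U V Z (x ⊗ₜ y) (v ⊗ₜ z) = (x • v) ⊗ₜ (y • z) := rfl

theorem tensorAction_tmul_one (x : ι → U) (i : ι) (u : V ⊗[ℂ] Z) :
    tensorAction U V Z (x i ⊗ₜ 1) u = (op V x i).rTensor Z u := by
  induction u with
  | zero => simp
  | tmul v z => simp
  | add a b ha hb => simp only [map_add, ha, hb]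

theorem tensorAction_one_tmul (x : ι → U) (i : ι) (u : V ⊗[ℂ] Z) :
    tensorAction U V Z (1 ⊗ₜ x i) u = (op Z x i).lTensor V u := by
  induction u with
  | zero => simp
  | tmul v z => simp
  | add a b ha hb => simp only [map_add, ha, hb]

/-- If the tensor product is a sum of weight spaces, then the span of the singular vectors
consists of all vectors annihilated by the positive generators. -/
theorem mem_singularSpan_iff {Δt : τ → U ⊗[ℂ] U} {Δe : ι → U ⊗[ℂ] U} {wt : W → τ → ℂ}
    (htop : ⨆ μ, eigen (fun s => tensorAction U V Z (Δt s)) (wt μ) = ⊤)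
    (hcomm : ∀ i s, ∃ y, Δe i * Δt s = y * Δe i) (u : V ⊗[ℂ] Z) :
    u ∈ singularSpan V Z Δt Δe wt ↔ ∀ i, tensorAction U V Z (Δe i) u = 0 := by
  let P : Submodule ℂ (V ⊗[ℂ] Z) := ⨅ i, LinearMap.ker (tensorAction U V Z (Δe i))
  have hP : ∀ u, u ∈ P ↔ ∀ i, tensorAction U V Z (Δe i) u = 0 := fun u => by simp [P]
  rw [← hP]
  constructor
  · intro hu
    exact (Submodule.span_le.2 fun u hu => (hP u).2 hu.2.2) hu
  · intro hu
    have h1 := le_span_eigen_of_stable (fun s => tensorAction U V Z (Δt s)) wt htop (P := P) (by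
      intro s w hw
      rw [hP] at hw ⊢
      intro i
      obtain ⟨y, hy⟩ := hcomm i s
      rw [← Module.End.mul_apply, ← map_mul, hy, map_mul, Module.End.mul_apply, hw, map_zero]) hu
    refine Submodule.span_mono ?_ h1
    rintro w ⟨h0, h2, h3⟩
    exact ⟨h0, h2, (hP w).1 h3⟩

/-- Weights add up in tensor products. -/
theorem iSup_eigen_tensor {τ₁ τ₂ : Type*} {tV : τ₁ → Module.End ℂ V} {tZ : τ₂ → Module.End ℂ Z}
    {ev₁ : W → τ₁ → ℂ} {ev₂ : W → τ₂ → ℂ} (hV : ⨆ μ, eigen tV (ev₁ μ) = ⊤)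
    (hZ : ⨆ μ, eigen tZ (ev₂ μ) = ⊤) {Δ : τ → Module.End ℂ (V ⊗[ℂ] Z)} {wt : W → τ → ℂ}
    (h : ∀ μ₁ μ₂, ∀ v ∈ eigen tV (ev₁ μ₁), ∀ z ∈ eigen tZ (ev₂ μ₂),
      ∃ μ, v ⊗ₜ[ℂ] z ∈ eigen Δ (wt μ)) : ⨆ μ, eigen Δ (wt μ) = ⊤ := by
  rw [eq_top_iff, ← TensorProduct.span_tmul_eq_top, Submodule.span_le]
  rintro _ ⟨v, z, rfl⟩
  have hv : v ∈ ⨆ μ, eigen tV (ev₁ μ) := hV ▸ Submodule.mem_top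
  have hz : z ∈ ⨆ μ, eigen tZ (ev₂ μ) := hZ ▸ Submodule.mem_top
  rw [SetLike.mem_coe]
  induction hv using Submodule.iSup_induction' with
  | zero => rw [TensorProduct.zero_tmul]; exact Submodule.zero_mem _
  | add a b _ _ ha hb => rw [TensorProduct.add_tmul]; exact Submodule.add_mem _ ha hb
  | mem μ₁ v hv =>
    induction hz using Submodule.iSup_induction' with
    | zero => rw [TensorProduct.tmul_zero]; exact Submodule.zero_mem _
    | add a b _ _ ha hb => rw [TensorProduct.tmul_add]; exact Submodule.add_mem _ ha hb
    | mem μ₂ z hz =>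
      obtain ⟨μ, hμ⟩ := h μ₁ μ₂ v hv z hz
      exact Submodule.mem_iSup_of_mem μ hμ

end Algebra

/-! ### Simple roots -/

section SimpleRoots

variable {ι : Type*} [Fintype ι] {𝔤 : Type*} [LieRing 𝔤] [LieAlgebra ℂ 𝔤] {H : LieSubalgebra ℂ 𝔤}

/-- The coordinates of `x` in the simple coroots are in the kernel of the Cartan matrix, whose
determinant is non-zero. -/
theorem eq_zero_of_baseSupp_apply (b : LieAlgebra.Basis ι H) (x : H)
    (hx : ∀ i, b.baseSupp i x = 0) : x = 0 := by
  classical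
  have hmem : (x : 𝔤) ∈ Submodule.span ℂ (Set.range b.h) := by
    rw [← b.coe_cartan_eq_span]; exact x.2
  obtain ⟨r, hr⟩ := (Submodule.mem_span_range_iff_exists_fun ℂ).1 hmem
  have hx' : x = ∑ j, r j • b.h' j := Subtype.ext (by
    rw [← hr, AddSubmonoidClass.coe_finsetSum]
    rfl)
  have hdet : (b.A.map (Int.cast : ℤ → ℂ)).det ≠ 0 := by
    have : (b.A.map (Int.cast : ℤ → ℂ)).det = (b.A.det : ℂ) :=
      ((Int.castRingHom ℂ).map_det b.A).symm
    rw [this]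
    exact_mod_cast b.nondegen.det_ne_zero
  have h0 : (b.A.map (Int.cast : ℤ → ℂ)).mulVec r = 0 := by
    funext i
    have := hx i
    rw [hx', map_sum] at this
    simpa [Matrix.mulVec, dotProduct, mul_comm] using this
  have hr0 := Matrix.eq_zero_of_mulVec_eq_zero hdet h0
  rw [hx', hr0]
  simp

theorem perm_of_sum_baseSupp (b : LieAlgebra.Basis ι H) {a a' : List ι}
    (h : (a.map b.baseSupp).sum = (a'.map b.baseSupp).sum) : a.Perm a' := by
  classical
  rw [List.perm_iff_count]
  intro i
  rw [Finset.sum_list_map_count, Finset.sum_list_map_count] at h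
  have key : ∀ l : List ι, ∑ j ∈ l.toFinset, l.count j • b.baseSupp j
      = ∑ j, (l.count j : ℂ) • b.baseSupp j := fun l => by
    rw [← Finset.sum_subset (Finset.subset_univ l.toFinset)]
    · exact Finset.sum_congr rfl fun j _ => (Nat.cast_smul_eq_nsmul ℂ _ _).symm
    · intro j _ hj
      rw [List.count_eq_zero_of_not_mem (by simpa using hj)]
      simp
  rw [key, key, ← sub_eq_zero, ← Finset.sum_sub_distrib] at h
  simp only [← sub_smul] at h
  have := Fintype.linearIndependent_iff.1 b.linearIndependent_baseSupp _ h i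
  exact_mod_cast sub_eq_zero.1 this

end SimpleRoots

/-! ### Rationality and non-degeneracy of the inner product -/

section InnerProduct

open LieAlgebra LieAlgebra.IsKilling

variable {ι : Type*} [Fintype ι] {𝔤 : Type*} [LieRing 𝔤] [LieAlgebra ℂ 𝔤] [FiniteDimensional ℂ 𝔤]
  [LieAlgebra.IsSemisimple ℂ 𝔤] {H : LieSubalgebra ℂ 𝔤} [H.IsCartanSubalgebra]

theorem dualForm_comm (c : ℚ) (μ lam : Module.Dual ℂ H) : dualForm c μ lam = dualForm c lam μ := by
  have key : ∀ μ lam : Module.Dual ℂ H, μ ((cartanEquivDual H).symm lam)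
      = LieModule.traceForm ℂ H 𝔤 ((cartanEquivDual H).symm μ) ((cartanEquivDual H).symm lam) :=
    fun μ lam => (LinearMap.congr_fun ((cartanEquivDual H).apply_symm_apply μ) _).symm
  simp only [dualForm, hElt, map_smul]
  rw [key μ lam, key lam μ, LieModule.traceForm_comm]

theorem dualForm_add_right (c : ℚ) (μ l₁ l₂ : Module.Dual ℂ H) :
    dualForm c μ (l₁ + l₂) = dualForm c μ l₁ + dualForm c μ l₂ := by
  simp [dualForm, hElt]

theorem dualForm_sub_right (c : ℚ) (μ l₁ l₂ : Module.Dual ℂ H) :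
    dualForm c μ (l₁ - l₂) = dualForm c μ l₁ - dualForm c μ l₂ := by
  simp [dualForm, hElt, smul_sub]

/-- With `a = α(T)` the coroot is `2 T / a`, so its Killing square is `4 / a`. That square is also
the sum over the roots `γ` of the squares of the integers `γ(α^∨)`. So `a` is rational, and `β(T) =
β(α^∨) a / 2`. -/
theorem exists_rat_root_apply (α β : H.root) :
    ∃ r : ℚ, LieModule.Weight.toLinear ℂ H 𝔤 β
      ((cartanEquivDual H).symm (LieModule.Weight.toLinear ℂ H 𝔤 α)) = r := by
  have hα : (α : LieModule.Weight ℂ H 𝔤).IsNonZero := LieSubalgebra.isNonZero_coe_root α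
  set T : H := (cartanEquivDual H).symm (LieModule.Weight.toLinear ℂ H 𝔤 α) with hT
  set a : ℂ := (α : LieModule.Weight ℂ H 𝔤) T with ha
  have ha0 : a ≠ 0 := root_apply_cartanEquivDual_symm_ne_zero hα
  have hco : coroot (α : LieModule.Weight ℂ H 𝔤) = (2 * a⁻¹) • T := by
    rw [coroot, mul_smul, two_smul, two_smul]
  have hint : ∀ γ : LieModule.Weight ℂ H 𝔤, ∃ n : ℤ,
      γ (coroot (α : LieModule.Weight ℂ H 𝔤)) = n := fun γ => ⟨_, apply_coroot_eq_cast _ γ⟩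
  choose n hn using hint
  have hT' : ∀ x, LieModule.traceForm ℂ H 𝔤 T x = (α : LieModule.Weight ℂ H 𝔤) x := fun x =>
    LinearMap.congr_fun ((cartanEquivDual H).apply_symm_apply _) x
  have hK : LieModule.traceForm ℂ H 𝔤 (coroot (α : LieModule.Weight ℂ H 𝔤))
      (coroot (α : LieModule.Weight ℂ H 𝔤)) = 4 * a⁻¹ := by
    conv_lhs => rw [hco]
    rw [map_smul, map_smul, LinearMap.smul_apply, hT', ← ha, smul_eq_mul, smul_eq_mul]
    field_simp
    norm_num
  have hK' : LieModule.traceForm ℂ H 𝔤 (coroot (α : LieModule.Weight ℂ H 𝔤))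
      (coroot (α : LieModule.Weight ℂ H 𝔤)) = ((∑ γ ∈ H.root, n γ * n γ : ℤ) : ℂ) := by
    rw [← restrict_killingForm, restrict_killingForm_eq_sum]
    simp [LinearMap.sum_apply, hn]
  rw [hK] at hK'
  set N : ℤ := ∑ γ ∈ H.root, n γ * n γ
  have haN : a = 4 * (N : ℂ)⁻¹ := by rw [← hK']; field_simp
  have hb : LieModule.Weight.toLinear ℂ H 𝔤 β T = n β * a / 2 := by
    have := hn β
    rw [hco, ← LieModule.Weight.toLinear_apply, map_smul, smul_eq_mul] at this
    rw [← this]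
    field_simp
  refine ⟨n β * (4 * (N : ℚ)⁻¹) / 2, ?_⟩
  rw [hb, haN]
  push_cast
  ring

theorem exists_rat_simpleForm (c : ℚ) (b : LieAlgebra.Basis ι H) (i j : ι) :
    ∃ r : ℚ, simpleForm c b i j = r := by
  obtain ⟨r, hr⟩ := exists_rat_root_apply (b.baseSupp' j) (b.baseSupp' i)
  refine ⟨c⁻¹ * r, ?_⟩
  rw [LieAlgebra.Basis.coe_linearMap_baseSupp', LieAlgebra.Basis.coe_linearMap_baseSupp'] at hr
  simp only [simpleForm, dualForm, hElt, map_smul, hr]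
  push_cast
  rfl

end InnerProduct

/-! ### Powers of `q` -/

section QPow

theorem qpow_add (ħ x y : ℂ) : qpow ħ (x + y) = qpow ħ x * qpow ħ y := by
  rw [qpow, mul_add, Complex.exp_add]; rfl

theorem qpow_neg_mul (ħ x : ℂ) : qpow ħ (-x) * qpow ħ x = 1 := by
  rw [← qpow_add, neg_add_cancel]; simp [qpow]

theorem qpow_mul_neg (ħ x : ℂ) : qpow ħ x * qpow ħ (-x) = 1 := by
  rw [mul_comm, qpow_neg_mul]

theorem qpow_ne_zero (ħ x : ℂ) : qpow ħ x ≠ 0 := Complex.exp_ne_zero _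

/-- Raising to the power `r.den` gives `q ^ r.num = 1`. -/
theorem eq_zero_of_qpow_eq_one {ħ : ℂ} (hq : ∀ n : ℕ, 0 < n → Complex.exp ħ ^ n ≠ 1) {r : ℚ}
    (h : qpow ħ r = 1) : r = 0 := by
  have h1 : Complex.exp (r.num * ħ) = 1 := by
    have h2 : qpow ħ r ^ r.den = 1 := by rw [h, one_pow]
    rw [qpow, ← Complex.exp_nat_mul] at h2
    rw [← h2]
    congr 1
    have : (r : ℂ) * r.den = r.num := by exact_mod_cast Rat.mul_den_eq_num r
    rw [← this]
    ring
  by_contra hr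
  obtain ⟨n, hn, h3⟩ : ∃ n : ℕ, 0 < n ∧ (r.num = n ∨ r.num = -n) :=
    ⟨_, Int.natAbs_pos.2 (Rat.num_ne_zero.2 hr), Int.natAbs_eq _⟩
  refine hq n hn ?_
  rw [← Complex.exp_nat_mul]
  rcases h3 with h3 | h3 <;> rw [h3] at h1
  · exact_mod_cast h1
  · push_cast at h1
    rwa [neg_mul, Complex.exp_neg, inv_eq_one] at h1

end QPow

/-! ### Highest weight modules over the quantum group -/

namespace QAlg

variable {ι : Type*} {ħ : ℂ} {A : Matrix ι ι ℤ} {B : ι → ι → ℂ}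

theorem k_mul_kInv (i : ι) : k ħ A B i * kInv ħ A B i = 1 := by
  simpa [of] using of_rel ħ A B (.k_kInv i)

theorem kInv_mul_k (i : ι) : kInv ħ A B i * k ħ A B i = 1 := by
  simpa [of] using of_rel ħ A B (.kInv_k i)

theorem k_comm (i j : ι) : k ħ A B i * k ħ A B j = k ħ A B j * k ħ A B i := by
  simpa [of] using of_rel ħ A B (.k_k i j)

theorem kInv_comm (i j : ι) : kInv ħ A B i * kInv ħ A B j = kInv ħ A B j * kInv ħ A B i := by
  simpa [of] using of_rel ħ A B (.kInv_kInv i j)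

theorem k_kInv_comm (i j : ι) : k ħ A B i * kInv ħ A B j = kInv ħ A B j * k ħ A B i := by
  calc k ħ A B i * kInv ħ A B j
      = kInv ħ A B j * (k ħ A B j * k ħ A B i) * kInv ħ A B j := by
        rw [← mul_assoc, kInv_mul_k, one_mul]
    _ = kInv ħ A B j * k ħ A B i := by
        rw [k_comm j i, mul_assoc, mul_assoc, k_mul_kInv, mul_one]

theorem k_mul_e (i j : ι) : k ħ A B i * e ħ A B j = qpow ħ (B i j) • (e ħ A B j * k ħ A B i) := by
  simpa [of] using of_rel ħ A B (.k_e i j)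

theorem kInv_mul_e (i j : ι) :
    kInv ħ A B i * e ħ A B j = qpow ħ (-B i j) • (e ħ A B j * kInv ħ A B i) := by
  simpa [of] using of_rel ħ A B (.kInv_e i j)

theorem k_mul_f (i j : ι) :
    k ħ A B i * f ħ A B j = qpow ħ (-B i j) • (f ħ A B j * k ħ A B i) := by
  simpa [of] using of_rel ħ A B (.k_f i j)

theorem kInv_mul_f (i j : ι) :
    kInv ħ A B i * f ħ A B j = qpow ħ (B i j) • (f ħ A B j * kInv ħ A B i) := by
  simpa [of] using of_rel ħ A B (.kInv_f i j)

theorem e_mul_k (i j : ι) : e ħ A B j * k ħ A B i = qpow ħ (-B i j) • (k ħ A B i * e ħ A B j) := by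
  rw [k_mul_e, smul_smul, qpow_neg_mul, one_smul]

theorem e_mul_kInv (i j : ι) :
    e ħ A B j * kInv ħ A B i = qpow ħ (B i j) • (kInv ħ A B i * e ħ A B j) := by
  rw [kInv_mul_e, smul_smul, qpow_mul_neg, one_smul]

theorem e_mul_f (i : ι) : e ħ A B i * f ħ A B i = f ħ A B i * e ħ A B i
    + (qpow ħ 1 - qpow ħ (-1))⁻¹ • (k ħ A B i - kInv ħ A B i) := by
  have h := of_rel ħ A B (.e_f i)
  rw [map_sub, sub_eq_iff_eq_add, add_comm] at h
  simpa [of] using h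

theorem e_mul_f_of_ne {i j : ι} (hij : i ≠ j) : e ħ A B i * f ħ A B j = f ħ A B j * e ħ A B i := by
  simpa [of] using of_rel ħ A B (.e_f_ne i j hij)

theorem adjoin_of : Algebra.adjoin ℂ (Set.range (of ħ A B)) = ⊤ := by
  have : Set.range (of ħ A B)
      = RingQuot.mkAlgHom ℂ (QRel ħ A B) '' Set.range (FreeAlgebra.ι ℂ) := by
    rw [← Set.range_comp]; rfl
  rw [this, ← AlgHom.map_adjoin, FreeAlgebra.adjoin_range_ι, Algebra.map_top,
    AlgHom.range_eq_top]
  exact RingQuot.mkAlgHom_surjective ℂ _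

/-- All Cartan generators `q^{h_α}`, `q^{-h_α}`. -/
def kk (ħ : ℂ) (A : Matrix ι ι ℤ) (B : ι → ι → ℂ) : ι ⊕ ι → QAlg ħ A B :=
  Sum.elim (k ħ A B) (kInv ħ A B)

/-- The elements `-q^{-h_α} e_α`. -/
def ke (ħ : ℂ) (A : Matrix ι ι ℤ) (B : ι → ι → ℂ) (i : ι) : QAlg ħ A B :=
  (-1 : ℂ) • (kInv ħ A B i * e ħ A B i)

theorem eq_bot_or_eq_top_of_stable {M : Type*} [AddCommGroup M] [Module ℂ M]
    [Module (QAlg ħ A B) M] [IsScalarTower ℂ (QAlg ħ A B) M] [IsSimpleModule (QAlg ħ A B) M]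
    (R : Submodule ℂ M) (he : ∀ i, ∀ w ∈ R, e ħ A B i • w ∈ R)
    (hf : ∀ i, ∀ w ∈ R, f ħ A B i • w ∈ R) (ht : ∀ s, ∀ w ∈ R, kk ħ A B s • w ∈ R) :
    R = ⊥ ∨ R = ⊤ := by
  refine Extremal.eq_bot_or_eq_top_of_stable (U := QAlg ħ A B) adjoin_of R ?_
  rintro _ ⟨g, rfl⟩
  cases g with
  | e i => exact he i
  | f i => exact hf i
  | k i => exact ht (.inl i)
  | kInv i => exact ht (.inr i)

/-- The factor that relates words in `-q^{-h_α} e_α` and words in `e_α`. -/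
def twist (ħ : ℂ) (A : Matrix ι ι ℤ) (B : ι → ι → ℂ) : List ι → QAlg ħ A B
  | [] => 1
  | i :: a => (-(a.map fun j => qpow ħ (B j i)).prod) • (kInv ħ A B i * twist ħ A B a)

/-- The scalar is the one built into `twist`, so that the factors `q^{-h}` of a word in `ke` can be
collected on the left. -/
theorem e_mul_twist (i : ι) (a : List ι) : e ħ A B i * twist ħ A B a
    = (a.map fun j => qpow ħ (B j i)).prod • (twist ħ A B a * e ħ A B i) := by
  induction a with
  | nil => simp [twist]
  | cons j a ih =>
    rw [twist, mul_smul_comm, ← mul_assoc, e_mul_kInv, smul_mul_assoc, mul_assoc, ih,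
      List.map_cons, List.prod_cons, smul_mul_assoc, mul_smul_comm, smul_smul, smul_smul, smul_smul,
      mul_assoc (kInv ħ A B j)]
    congr 1
    ring

theorem word_ke (a : List ι) : word (ke ħ A B) a = twist ħ A B a * word (e ħ A B) a := by
  induction a with
  | nil => simp [twist]
  | cons i a ih =>
    rw [word_cons, word_cons, ih, ke, smul_mul_assoc, mul_assoc, ← mul_assoc (e ħ A B i),
      e_mul_twist, twist, smul_mul_assoc, smul_mul_assoc, mul_smul_comm, smul_smul, neg_one_mul]
    simp only [mul_assoc]

/-- Exchanging neighbours exchanges commuting elements `q^{-h}` and replaces the scalar `q^{B i j}`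
by `q^{B j i}`. -/
theorem twist_perm (hB : ∀ i j, B i j = B j i) {a b : List ι} (h : a.Perm b) :
    twist ħ A B a = twist ħ A B b := by
  induction h with
  | nil => rfl
  | cons i h ih => rw [twist, twist, ih, (h.map _).prod_eq]
  | swap i j a =>
    simp only [twist, List.map_cons, List.prod_cons, mul_smul_comm, smul_smul]
    rw [← mul_assoc, ← mul_assoc, kInv_comm i j, hB i j]
    congr 1
    ring
  | trans _ _ h1 h2 => exact h1.trans h2

theorem exists_mul_twist (a : List ι) : ∃ y, y * twist ħ A B a = 1 := by
  induction a with
  | nil => exact ⟨1, by simp [twist]⟩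
  | cons i a ih =>
    obtain ⟨y, hy⟩ := ih
    have h0 : (a.map fun j => qpow ħ (B j i)).prod ≠ 0 := by
      refine List.prod_ne_zero fun h => ?_
      obtain ⟨j, -, hj⟩ := List.mem_map.1 h
      exact qpow_ne_zero _ _ hj
    refine ⟨(-(a.map fun j => qpow ħ (B j i)).prod)⁻¹ • (y * k ħ A B i), ?_⟩
    rw [twist, smul_mul_smul_comm, inv_mul_cancel₀ (neg_ne_zero.2 h0), one_smul, mul_assoc,
      ← mul_assoc (k ħ A B i), k_mul_kInv, one_mul, hy]

/-- Each element of `U_q(𝔤₋)` is a combination of words in the `f_α`, and `σ` sends it to the same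
combination of words in the `e_α`. -/
theorem mem_idealKer_idealPlus_iff {V Z : Type*} [AddCommGroup V] [Module ℂ V]
    [Module (QAlg ħ A B) V] [IsScalarTower ℂ (QAlg ħ A B) V] [AddCommGroup Z] [Module ℂ Z]
    [Module (QAlg ħ A B) Z] [IsScalarTower ℂ (QAlg ħ A B) Z] (z : Z) (w : V) :
    w ∈ idealKer (idealPlus ħ A B z) V ↔
      ∀ c, wordEval (op Z (f ħ A B)) z c = 0 → wordEval (op V (e ħ A B)) w c = 0 := by
  have hσ : ∀ c, sigma ħ A B (wordSum (f ħ A B) c) = wordSum (e ħ A B) c := by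
    intro c
    refine (map_wordSum (sigma ħ A B : QAlg ħ A B →ₐ[ℂ] QAlg ħ A B) (f ħ A B) c).trans ?_
    exact congrArg (fun x => wordSum x c) (funext fun i => sigma_of ħ A B (.f i))
  rw [mem_idealKer_iff, idealPlus, Ideal.map_le_iff_le_comap]
  constructor
  · intro h c hc
    have h1 : (⟨wordSum (f ħ A B) c, mem_gen_iff.2 ⟨c, rfl⟩⟩ : gen (f ħ A B))
        ∈ annMinus (f ħ A B) z := by
      rw [mem_annMinus, wordSum_smul, hc]
    have h2 := (Ideal.mem_torsionOf_iff _ _).1 (Ideal.mem_comap.1 (h h1))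
    rw [← wordSum_smul, ← hσ]
    exact h2
  · rintro h ⟨x, hx⟩ hx'
    obtain ⟨c, rfl⟩ := mem_gen_iff.1 hx
    rw [mem_annMinus, wordSum_smul] at hx'
    rw [Ideal.mem_comap, Ideal.mem_torsionOf_iff]
    have h2 := h c hx'
    rw [← wordSum_smul, ← hσ] at h2
    exact h2

theorem tensorAction_comul_e_eq_zero_iff {V Z : Type*} [AddCommGroup V] [Module ℂ V]
    [Module (QAlg ħ A B) V] [IsScalarTower ℂ (QAlg ħ A B) V] [AddCommGroup Z] [Module ℂ Z]
    [Module (QAlg ħ A B) Z] [IsScalarTower ℂ (QAlg ħ A B) Z] (i : ι) (u : V ⊗[ℂ] Z) :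
    tensorAction _ V Z (comul ħ A B (.e i)) u = 0 ↔
      (op V (e ħ A B) i).rTensor Z u = (op Z (ke ħ A B) i).lTensor V u := by
  let d : QAlg ħ A B ⊗[ℂ] QAlg ħ A B := e ħ A B i ⊗ₜ[ℂ] 1 + 1 ⊗ₜ[ℂ] (kInv ħ A B i * e ħ A B i)
  -- Here `d = (1 ⊗ q^{-h}) Δ(e)`; as `1 ⊗ q^{-h}` is invertible, `d` and `Δ(e)` have the same
  -- kernel.
  have hd : tensorAction _ V Z d u = 0 ↔
      (op V (e ħ A B) i).rTensor Z u = (op Z (ke ħ A B) i).lTensor V u := by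
    rw [← tensorAction_tmul_one, ← tensorAction_one_tmul, ke, TensorProduct.tmul_smul, map_smul,
      LinearMap.smul_apply, neg_one_smul, ← add_eq_zero_iff_eq_neg, ← LinearMap.add_apply, ← map_add]
  have h1 : (1 ⊗ₜ kInv ħ A B i) * comul ħ A B (.e i) = d := by
    simp [d, comul, mul_add, kInv_mul_k]
  have h2 : (1 ⊗ₜ k ħ A B i) * d = comul ħ A B (.e i) := by
    rw [← h1, ← mul_assoc, Algebra.TensorProduct.tmul_mul_tmul, k_mul_kInv, mul_one,
      ← Algebra.TensorProduct.one_def, one_mul]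
  rw [← hd]
  constructor
  · intro h
    rw [← h1, map_mul, Module.End.mul_apply, h, map_zero]
  · intro h
    rw [← h2, map_mul, Module.End.mul_apply, h, map_zero]

end QAlg

namespace QuantumGroup

variable {ι : Type*} [Fintype ι] {𝔤 : Type*} [LieRing 𝔤] [LieAlgebra ℂ 𝔤] [FiniteDimensional ℂ 𝔤]
  [LieAlgebra.IsSemisimple ℂ 𝔤] {H : LieSubalgebra ℂ 𝔤} [H.IsCartanSubalgebra]
  {ħ : ℂ} {c : ℚ} {b : LieAlgebra.Basis ι H}

theorem simpleForm_comm (i j : ι) : simpleForm c b i j = simpleForm c b j i := dualForm_comm _ _ _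

/-- The eigenvalues of all elements `q^{h_α}`, `q^{-h_α}` on vectors of weight `μ`. -/
def weight (ħ : ℂ) (c : ℚ) (b : LieAlgebra.Basis ι H) (μ : Module.Dual ℂ H) : ι ⊕ ι → ℂ :=
  Sum.elim (qWeight ħ c b μ) fun i => qpow ħ (-dualForm c (b.baseSupp i) μ)

theorem qWeight_sub (μ : Module.Dual ℂ H) (i s : ι) :
    qWeight ħ c b (μ - b.baseSupp i) s = qpow ħ (-simpleForm c b s i) * qWeight ħ c b μ s := by
  rw [qWeight, dualForm_sub_right, sub_eq_add_neg, qpow_add, mul_comm]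
  rfl

/-- The difference `d` of the two sums of simple roots has rational products with the simple roots,
and `q` to each of these powers is `1`. So the products vanish, whence `d = 0`, and the simple roots
are linearly independent. -/
theorem perm_of_qWeight (hc : c ≠ 0) (hq : ∀ n : ℕ, 0 < n → Complex.exp ħ ^ n ≠ 1)
    {ν : Module.Dual ℂ H} {a a' : List ι}
    (h : qWeight ħ c b (ν - (a.map b.baseSupp).sum) = qWeight ħ c b (ν - (a'.map b.baseSupp).sum)) :
    a.Perm a' := by
  apply perm_of_sum_baseSupp b
  have hrat : ∀ (s : ι) (l : List ι),
      ∃ r : ℚ, dualForm c (b.baseSupp s) (l.map b.baseSupp).sum = r := by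
    intro s l
    induction l with
    | nil => exact ⟨0, by simp [dualForm, hElt]⟩
    | cons i l ih =>
      obtain ⟨r, hr⟩ := ih
      obtain ⟨r', hr'⟩ := exists_rat_simpleForm c b s i
      refine ⟨r' + r, ?_⟩
      rw [List.map_cons, List.sum_cons, dualForm_add_right, hr]
      rw [simpleForm] at hr'
      rw [hr']
      push_cast
      rfl
  rw [← sub_eq_zero]
  set d := (a.map b.baseSupp).sum - (a'.map b.baseSupp).sum with hd
  have h0 : ∀ s, dualForm c (b.baseSupp s) d = 0 := by
    intro s
    obtain ⟨r, hr⟩ := hrat s a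
    obtain ⟨r', hr'⟩ := hrat s a'
    have h1 : dualForm c (b.baseSupp s) d = ((r - r' : ℚ) : ℂ) := by
      rw [hd, dualForm_sub_right, hr, hr']
      push_cast
      rfl
    have h2 := congrFun h s
    simp only [qWeight] at h2
    have h3 : dualForm c (b.baseSupp s) (ν - (a'.map b.baseSupp).sum)
        = dualForm c (b.baseSupp s) d
          + dualForm c (b.baseSupp s) (ν - (a.map b.baseSupp).sum) := by
      rw [← dualForm_add_right]
      congr 1
      rw [hd]
      abel
    rw [h3, qpow_add, eq_comm, mul_eq_right₀ (qpow_ne_zero _ _), h1] at h2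
    rw [h1, eq_zero_of_qpow_eq_one hq h2]
    simp
  have h4 : hElt c d = 0 := eq_zero_of_baseSupp_apply b _ h0
  rw [hElt, smul_eq_zero] at h4
  have hc' : (c : ℂ)⁻¹ ≠ 0 := inv_ne_zero (by exact_mod_cast hc)
  exact (LinearEquiv.map_eq_zero_iff _).1 (h4.resolve_left hc')

section Module

open QAlg

variable {M : Type*} [AddCommGroup M] [Module ℂ M] [Module (QuantumGroup ħ c b) M]
  [IsScalarTower ℂ (QuantumGroup ħ c b) M]

theorem mem_eigen_kk {μ : Module.Dual ℂ H} {w : M} :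
    w ∈ eigen (op M (kk ħ b.A (simpleForm c b))) (weight ħ c b μ) ↔
      ∀ s, k ħ c b s • w = qWeight ħ c b μ s • w := by
  constructor
  · intro h s
    exact h (.inl s)
  · rintro h (s | s)
    · exact h s
    · have h1 := congrArg (fun w => kInv ħ b.A (simpleForm c b) s • w) (h s)
      simp only [← mul_smul, kInv_mul_k, one_smul] at h1
      rw [smul_comm] at h1
      have h2 := congrArg (fun w => qpow ħ (-dualForm c (b.baseSupp s) μ) • w) h1
      simp only [smul_smul, qWeight, qpow_neg_mul, one_smul] at h2
      exact h2.symm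

theorem mem_eigen_dual {μ : Module.Dual ℂ H} {φ : Module.Dual ℂ M} :
    φ ∈ eigen (fun s => (op M (kk ħ b.A (simpleForm c b)) s).dualMap) (weight ħ c b μ) ↔
      ∀ s w, φ (k ħ c b s • w) = qWeight ħ c b μ s * φ w := by
  constructor
  · intro h s w
    exact LinearMap.congr_fun (h (.inl s)) w
  · rintro h (s | s)
    · exact LinearMap.ext fun w => h s w
    · refine LinearMap.ext fun w => ?_
      have h1 := h s (kInv ħ b.A (simpleForm c b) s • w)
      rw [← mul_smul, k_mul_kInv, one_smul] at h1
      change φ (kInv ħ b.A (simpleForm c b) s • w) = qpow ħ (-dualForm c (b.baseSupp s) μ) * φ w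
      rw [h1, qWeight, ← mul_assoc, qpow_neg_mul, one_mul]

theorem f_mem_eigen (i : ι) (μ : Module.Dual ℂ H) (w : M)
    (hw : w ∈ eigen (op M (kk ħ b.A (simpleForm c b))) (weight ħ c b μ)) :
    op M (f ħ b.A (simpleForm c b)) i w
      ∈ eigen (op M (kk ħ b.A (simpleForm c b))) (weight ħ c b (μ - b.baseSupp i)) := by
  rw [mem_eigen_kk] at hw ⊢
  intro s
  rw [op_apply, ← mul_smul, k_mul_f, smul_assoc, mul_smul, hw,
    smul_comm (f ħ b.A (simpleForm c b) i), qWeight_sub, mul_smul]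

/-- Stated for any `x` of weight `α_i`, to serve both `e_α` and `-q^{-h_α} e_α`. -/
theorem dual_mem_eigen {x : ι → QuantumGroup ħ c b}
    (hx : ∀ i s, x i * k ħ c b s = qpow ħ (-simpleForm c b s i) • (k ħ c b s * x i))
    (i : ι) (μ : Module.Dual ℂ H) (φ : Module.Dual ℂ M)
    (hφ : φ ∈ eigen (fun s => (op M (kk ħ b.A (simpleForm c b)) s).dualMap) (weight ħ c b μ)) :
    (op M x i).dualMap φ ∈ eigen (fun s => (op M (kk ħ b.A (simpleForm c b)) s).dualMap)
      (weight ħ c b (μ - b.baseSupp i)) := by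
  rw [mem_eigen_dual] at hφ ⊢
  intro s w
  rw [LinearMap.dualMap_apply, op_apply, ← mul_smul, hx, smul_assoc, mul_smul, map_smul, hφ,
    qWeight_sub, smul_eq_mul, mul_assoc]
  rfl

variable [IsSimpleModule (QuantumGroup ħ c b) M]

/-- The coefficient `(q - q⁻¹)⁻¹`. -/
def coef (ħ : ℂ) : ℂ := (qpow ħ 1 - qpow ħ (-1))⁻¹

theorem system_e (hc : c ≠ 0) (hq : ∀ n : ℕ, 0 < n → Complex.exp ħ ^ n ≠ 1)
    {ν : Module.Dual ℂ H} {m : M}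
    (hm : IsHighestVector (k ħ c b) (e ħ c b) (qWeight ħ c b ν) m) :
    IsHighestWeightSystem b.baseSupp (weight ħ c b) (op M (e ħ c b))
      (op M (f ħ b.A (simpleForm c b)))
      (op M fun i => coef ħ • (k ħ c b i - kInv ħ b.A (simpleForm c b) i))
      (op M (kk ħ b.A (simpleForm c b))) (fun _ _ => 1)
      (fun i μ => coef ħ * (weight ħ c b μ (.inl i) - weight ħ c b μ (.inr i))) ν m where
  ne_zero := hm.1
  mem_eigen := mem_eigen_kk.2 hm.2.1
  apply_eq_zero := hm.2.2.1
  q_symm _ _ := rfl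
  comm_ne i j hij w := by
    simp only [op_apply, one_smul, ← mul_smul]
    rw [e_mul_f_of_ne hij]
  comm_self i w := by
    simp only [op_apply, one_smul, ← mul_smul]
    rw [← add_smul, e_mul_f]
    rfl
  y_mem := f_mem_eigen
  x_mem := dual_mem_eigen fun i s => e_mul_k s i
  g_eigen i μ w hw := by
    have h1 : k ħ c b i • w = _ := hw (.inl i)
    have h2 : kInv ħ b.A (simpleForm c b) i • w = _ := hw (.inr i)
    rw [op_apply, smul_assoc, sub_smul, h1, h2, ← sub_smul, smul_smul]
  g_dual i μ φ hφ := by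
    refine LinearMap.ext fun w => ?_
    have h1 : φ (k ħ c b i • w) = _ := LinearMap.congr_fun (hφ (.inl i)) w
    have h2 : φ (kInv ħ b.A (simpleForm c b) i • w) = _ := LinearMap.congr_fun (hφ (.inr i)) w
    rw [LinearMap.dualMap_apply, op_apply, smul_assoc, sub_smul, map_smul, map_sub, h1, h2]
    simp only [LinearMap.smul_apply, smul_eq_mul]
    ring
  perm a a' h := perm_of_qWeight hc hq (funext fun s => congrFun h (.inl s))
  irreducible R hx hy ht := QAlg.eq_bot_or_eq_top_of_stable R hx hy ht

theorem ke_mul_k (i s : ι) : ke ħ b.A (simpleForm c b) i * k ħ c b s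
    = qpow ħ (-simpleForm c b s i) • (k ħ c b s * ke ħ b.A (simpleForm c b) i) := by
  rw [ke, smul_mul_assoc, mul_assoc, e_mul_k, mul_smul_comm, ← mul_assoc, ← k_kInv_comm,
    mul_smul_comm, mul_assoc, smul_comm]

/-- From `[e, f] = (q^h - q^{-h}) / (q - q⁻¹)` one gets `x f = q^{(α, α)} f x + (q^{-2h} - 1) / (q -
q⁻¹)` for `x = -q^{-h} e`, hence the scalars `q i j` and the diagonal operators. -/
theorem system_ke (hc : c ≠ 0) (hq : ∀ n : ℕ, 0 < n → Complex.exp ħ ^ n ≠ 1)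
    {ν : Module.Dual ℂ H} {m : M}
    (hm : IsHighestVector (k ħ c b) (e ħ c b) (qWeight ħ c b ν) m) :
    IsHighestWeightSystem b.baseSupp (weight ħ c b) (op M (ke ħ b.A (simpleForm c b)))
      (op M (f ħ b.A (simpleForm c b)))
      (op M fun i => coef ħ • (kInv ħ b.A (simpleForm c b) i * kInv ħ b.A (simpleForm c b) i - 1))
      (op M (kk ħ b.A (simpleForm c b))) (fun i j => qpow ħ (simpleForm c b i j))
      (fun i μ => coef ħ * (weight ħ c b μ (.inr i) * weight ħ c b μ (.inr i) - 1)) ν m where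
  ne_zero := hm.1
  mem_eigen := mem_eigen_kk.2 hm.2.1
  apply_eq_zero i := by
    rw [op_apply, ke, smul_assoc, mul_smul, hm.2.2.1, smul_zero, smul_zero]
  q_symm i j := by rw [simpleForm_comm]
  comm_ne i j hij w := by
    simp only [op_apply, ← mul_smul]
    rw [← smul_assoc, ke, smul_mul_assoc, mul_assoc, e_mul_f_of_ne hij, ← mul_assoc, kInv_mul_f,
      smul_mul_assoc, mul_smul_comm, smul_comm, mul_assoc]
  comm_self i w := by
    simp only [op_apply, ← mul_smul]
    rw [← smul_assoc, ← add_smul]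
    congr 1
    have h1 : kInv ħ b.A (simpleForm c b) i * (k ħ c b i - kInv ħ b.A (simpleForm c b) i)
        = 1 - kInv ħ b.A (simpleForm c b) i * kInv ħ b.A (simpleForm c b) i := by
      rw [mul_sub, kInv_mul_k]
    rw [ke, smul_mul_assoc, mul_assoc, e_mul_f, mul_add, ← mul_assoc, kInv_mul_f, mul_smul_comm,
      h1, smul_mul_assoc, mul_smul_comm, smul_add, smul_comm, mul_assoc]
    congr 1
    rw [smul_comm, neg_one_smul, neg_sub]
    rfl
  y_mem := f_mem_eigen
  x_mem := dual_mem_eigen ke_mul_k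
  g_eigen i μ w hw := by
    have h2 : kInv ħ b.A (simpleForm c b) i • w = _ := hw (.inr i)
    rw [op_apply, smul_assoc, sub_smul, mul_smul, h2, smul_comm, h2, one_smul, mul_smul,
      sub_smul, mul_smul, one_smul]
  g_dual i μ φ hφ := by
    refine LinearMap.ext fun w => ?_
    have h2 : ∀ w, φ (kInv ħ b.A (simpleForm c b) i • w) = _ :=
      fun w => LinearMap.congr_fun (hφ (.inr i)) w
    rw [LinearMap.dualMap_apply, op_apply, smul_assoc, sub_smul, mul_smul, map_smul, map_sub, h2,
      one_smul]
    simp only [LinearMap.smul_apply, smul_eq_mul, h2]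
    ring
  perm a a' h := perm_of_qWeight hc hq (funext fun s => congrFun h (.inl s))
  irreducible R hx hy ht := by
    refine QAlg.eq_bot_or_eq_top_of_stable R (fun i w hw => ?_) hy ht
    -- Stability under the Cartan part recovers `e = -q^h x` from `x = -q^{-h} e`.
    have h1 : e ħ c b i • w = (-1 : ℂ) • k ħ c b i • ke ħ b.A (simpleForm c b) i • w := by
      rw [ke, smul_assoc, smul_comm (k ħ c b i) (-1 : ℂ), smul_smul, ← mul_smul, ← mul_assoc,
        k_mul_kInv, one_mul]
      simp
    rw [h1]
    exact R.smul_mem _ (ht (.inl i) _ (hx i w hw))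

end Module

open QAlg in
theorem mem_singular_iff {V Z : Type*} [AddCommGroup V] [Module ℂ V]
    [Module (QuantumGroup ħ c b) V] [IsScalarTower ℂ (QuantumGroup ħ c b) V]
    [AddCommGroup Z] [Module ℂ Z] [Module (QuantumGroup ħ c b) Z]
    [IsScalarTower ℂ (QuantumGroup ħ c b) Z]
    (hV : ⨆ μ, eigen (op V (kk ħ b.A (simpleForm c b))) (weight ħ c b μ) = ⊤)
    (hZ : ⨆ μ, eigen (op Z (kk ħ b.A (simpleForm c b))) (weight ħ c b μ) = ⊤) (u : V ⊗[ℂ] Z) :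
    u ∈ singular ħ c b V Z ↔ ∀ i, (op V (e ħ c b) i).rTensor Z u
      = (op Z (ke ħ b.A (simpleForm c b)) i).lTensor V u := by
  rw [singular, mem_singularSpan_iff]
  · exact forall_congr' fun i => tensorAction_comul_e_eq_zero_iff i u
  · refine iSup_eigen_tensor hV hZ fun μ₁ μ₂ v hv z hz => ⟨μ₁ + μ₂, fun s => ?_⟩
    rw [mem_eigen_kk] at hv hz
    change (k ħ c b s • v) ⊗ₜ[ℂ] (k ħ c b s • z) = _
    rw [hv, hz, TensorProduct.smul_tmul_smul, qWeight, qWeight, qWeight, dualForm_add_right,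
      qpow_add]
  · intro i s
    refine ⟨qpow ħ (-simpleForm c b s i) • comul ħ b.A (simpleForm c b) (.k s), ?_⟩
    simp only [comul, add_mul, mul_add, Algebra.TensorProduct.tmul_mul_tmul, smul_mul_assoc,
      one_mul, mul_one]
    rw [e_mul_k, k_comm i s, TensorProduct.smul_tmul', TensorProduct.tmul_smul]

end QuantumGroup

/-! ### Highest weight modules over the universal enveloping algebra -/

namespace Classical

variable {ι : Type*} [Fintype ι] {𝔤 : Type*} [LieRing 𝔤] [LieAlgebra ℂ 𝔤]
  {H : LieSubalgebra ℂ 𝔤} {b : LieAlgebra.Basis ι H}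

section Associative

attribute [local instance] LieRing.ofAssociativeRing

/-- The canonical map of `𝔤` lands in the subalgebra and so lifts to `U(𝔤)`. By the universal
property the lift followed by the inclusion is the identity. -/
theorem adjoin_range_ι :
    Algebra.adjoin ℂ (Set.range (UniversalEnvelopingAlgebra.ι ℂ (L := 𝔤))) = ⊤ := by
  let S := Algebra.adjoin ℂ (Set.range (UniversalEnvelopingAlgebra.ι ℂ (L := 𝔤)))
  let F : 𝔤 →ₗ⁅ℂ⁆ S :=
    { toFun := fun x => ⟨UniversalEnvelopingAlgebra.ι ℂ x, Algebra.subset_adjoin ⟨x, rfl⟩⟩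
      map_add' := fun x y => Subtype.ext (map_add _ x y)
      map_smul' := fun r x => Subtype.ext (map_smul _ r x)
      map_lie' := fun {x y} => Subtype.ext (LieHom.map_lie _ x y) }
  have h : S.val.comp (UniversalEnvelopingAlgebra.lift ℂ F) = AlgHom.id ℂ _ := by
    apply UniversalEnvelopingAlgebra.hom_ext
    ext x
    simp [F]
  rw [eq_top_iff]
  intro u _
  have := AlgHom.congr_fun h u
  rw [AlgHom.id_apply] at this
  rw [← this]
  exact (UniversalEnvelopingAlgebra.lift ℂ F u).2

theorem ι_lie (x y : 𝔤) : UniversalEnvelopingAlgebra.ι ℂ ⁅x, y⁆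
    = UniversalEnvelopingAlgebra.ι ℂ x * UniversalEnvelopingAlgebra.ι ℂ y
      - UniversalEnvelopingAlgebra.ι ℂ y * UniversalEnvelopingAlgebra.ι ℂ x := by
  rw [LieHom.map_lie, Ring.lie_def]

end Associative

theorem t_mul_e (h : H) (i : ι) : t H h * e b i = e b i * t H h + b.baseSupp i h • e b i := by
  have h1 : ⁅(h : 𝔤), b.e i⁆ = b.baseSupp i h • b.e i := (b.baseSupp_apply_smul_e i h).symm
  rw [e, ← map_smul, ← h1, ι_lie]
  simp [t]

theorem t_mul_f (h : H) (i : ι) : t H h * f b i = f b i * t H h - b.baseSupp i h • f b i := by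
  have h1 : ⁅(h : 𝔤), b.f i⁆ = -(b.baseSupp i h • b.f i) := by
    rw [b.baseSupp_apply_smul_f i h, neg_neg]
    rfl
  rw [f, ← map_smul, sub_eq_add_neg, ← map_neg, ← h1, ι_lie]
  simp [t]

theorem e_mul_f (i : ι) : e b i * f b i = f b i * e b i + t H (b.h' i) := by
  have h1 : ((b.h' i : H) : 𝔤) = ⁅b.e i, b.f i⁆ := (b.sl2 i).lie_e_f.symm
  rw [t, h1, ι_lie]
  simp [e, f]

theorem e_mul_f_of_ne {i j : ι} (hij : i ≠ j) : e b i * f b j = f b j * e b i := by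
  have h := ι_lie (b.e i) (b.f j)
  rw [b.lie_e_f_ne i j hij, map_zero] at h
  exact sub_eq_zero.1 h.symm

theorem adjoin_e_f : Algebra.adjoin ℂ (Set.range (e b) ∪ Set.range (f b)) = ⊤ := by
  rw [eq_top_iff, ← adjoin_range_ι, Algebra.adjoin_le_iff]
  rintro _ ⟨x, rfl⟩
  have hx : x ∈ LieSubalgebra.lieSpan ℂ 𝔤 (Set.range b.e ∪ Set.range b.f) := by
    rw [b.span_ef]; trivial
  rw [SetLike.mem_coe]
  induction hx using LieSubalgebra.lieSpan_induction with
  | mem x hx =>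
    rcases hx with ⟨i, rfl⟩ | ⟨i, rfl⟩
    · exact Algebra.subset_adjoin (.inl ⟨i, rfl⟩)
    · exact Algebra.subset_adjoin (.inr ⟨i, rfl⟩)
  | zero => rw [map_zero]; exact Subalgebra.zero_mem _
  | add x y _ _ hx hy => rw [map_add]; exact Subalgebra.add_mem _ hx hy
  | smul r x _ hx => rw [map_smul]; exact Subalgebra.smul_mem _ hx r
  | lie x y _ _ hx hy =>
    rw [ι_lie]
    exact Subalgebra.sub_mem _ (Subalgebra.mul_mem _ hx hy) (Subalgebra.mul_mem _ hy hx)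

section Module

variable {M : Type*} [AddCommGroup M] [Module ℂ M] [Module (UniversalEnvelopingAlgebra ℂ 𝔤) M]
  [IsScalarTower ℂ (UniversalEnvelopingAlgebra ℂ 𝔤) M]

theorem mem_eigen_dual {μ : Module.Dual ℂ H} {φ : Module.Dual ℂ M} :
    φ ∈ eigen (fun s => (op M (t H) s).dualMap) (fun h => μ h) ↔
      ∀ h w, φ (t H h • w) = μ h * φ w :=
  forall_congr' fun _ => LinearMap.ext_iff

theorem f_mem_eigen (i : ι) (μ : Module.Dual ℂ H) (w : M)
    (hw : w ∈ eigen (op M (t H)) fun h => μ h) :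
    op M (f b) i w ∈ eigen (op M (t H)) fun h => (μ - b.baseSupp i) h := by
  intro h
  have h1 : t H h • w = μ h • w := hw h
  rw [op_apply, op_apply, ← mul_smul, t_mul_f, sub_smul, mul_smul, h1, smul_assoc,
    smul_comm (f b i), ← sub_smul]
  rfl

variable [IsSimpleModule (UniversalEnvelopingAlgebra ℂ 𝔤) M]

/-- The factor `r` is `1` on `V` and `-1` on `Z`, since `Δ(e) u = 0` reads `(e ⊗ 1) u = (1 ⊗ (-e))
u`. -/
theorem system {r : ℂ} (hr : r ≠ 0) {ν : Module.Dual ℂ H} {m : M}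
    (hm : IsHighestVector (t H) (e b) (fun h => ν h) m) :
    IsHighestWeightSystem b.baseSupp (fun (μ : Module.Dual ℂ H) (h : H) => μ h)
      (op M fun i => r • e b i) (op M (f b)) (op M fun i => r • t H (b.h' i)) (op M (t H))
      (fun _ _ => 1) (fun i μ => r * μ (b.h' i)) ν m where
  ne_zero := hm.1
  mem_eigen := hm.2.1
  apply_eq_zero i := by rw [op_apply, smul_assoc, hm.2.2.1, smul_zero]
  q_symm _ _ := rfl
  comm_ne i j hij w := by
    simp only [op_apply, one_smul, ← mul_smul]
    rw [smul_mul_assoc, mul_smul_comm, e_mul_f_of_ne hij]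
  comm_self i w := by
    simp only [op_apply, one_smul, ← mul_smul]
    rw [← add_smul, smul_mul_assoc, mul_smul_comm, e_mul_f, smul_add]
  y_mem := f_mem_eigen
  x_mem i μ φ hφ := by
    rw [mem_eigen_dual] at hφ ⊢
    intro h w
    have h1 : e b i * t H h = t H h * e b i - b.baseSupp i h • e b i := by
      rw [t_mul_e, add_sub_cancel_right]
    rw [LinearMap.dualMap_apply, LinearMap.dualMap_apply, op_apply, op_apply, ← mul_smul,
      smul_mul_assoc, h1, smul_assoc, smul_assoc, sub_smul, mul_smul, smul_assoc, φ.map_smul,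
      φ.map_smul, φ.map_sub, φ.map_smul, hφ, LinearMap.sub_apply]
    simp only [smul_eq_mul]
    ring
  g_eigen i μ w hw := by
    have h1 : t H (b.h' i) • w = μ (b.h' i) • w := hw (b.h' i)
    rw [op_apply, smul_assoc, h1, smul_smul]
  g_dual i μ φ hφ := by
    rw [mem_eigen_dual] at hφ
    refine LinearMap.ext fun w => ?_
    rw [LinearMap.dualMap_apply, op_apply, smul_assoc, map_smul, hφ, LinearMap.smul_apply,
      smul_eq_mul, smul_eq_mul, mul_assoc]
  perm a a' h := by
    have h1 : ν - (a.map b.baseSupp).sum = ν - (a'.map b.baseSupp).sum :=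
      LinearMap.ext fun x => congrFun h x
    exact perm_of_sum_baseSupp b (sub_right_injective h1)
  irreducible R hx hy _ := by
    refine eq_bot_or_eq_top_of_stable (adjoin_e_f (b := b)) R ?_
    rintro _ (⟨i, rfl⟩ | ⟨i, rfl⟩) w hw
    · have := R.smul_mem r⁻¹ (hx i w hw)
      rwa [op_apply, smul_assoc, inv_smul_smul₀ hr] at this
    · exact hy i w hw

end Module

section Tensor

variable {V Z : Type*} [AddCommGroup V] [Module ℂ V]
  [Module (UniversalEnvelopingAlgebra ℂ 𝔤) V] [IsScalarTower ℂ (UniversalEnvelopingAlgebra ℂ 𝔤) V]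
  [AddCommGroup Z] [Module ℂ Z] [Module (UniversalEnvelopingAlgebra ℂ 𝔤) Z]
  [IsScalarTower ℂ (UniversalEnvelopingAlgebra ℂ 𝔤) Z]

theorem mem_extremal_iff (z : Z) (w : V) : w ∈ extremal b V z ↔
    ∀ c, wordEval (op Z (f b)) z c = 0 → wordEval (op V (e b)) w c = 0 := by
  have hev : ∀ (x : ι → UniversalEnvelopingAlgebra ℂ 𝔤) c,
      (evalGen x (wordSum (FreeAlgebra.ι ℂ) c) : UniversalEnvelopingAlgebra ℂ 𝔤)
        = wordSum x c := by
    intro x c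
    refine (map_wordSum ((gen x).val.comp (evalGen x)) (FreeAlgebra.ι ℂ) c).trans ?_
    exact congrArg (fun x => wordSum x c) (funext fun i => by simp [evalGen])
  rw [extremal, mem_idealKer_iff, idealPlus, Ideal.map_le_iff_le_comap]
  constructor
  · intro h c hc
    have h1 : wordSum (FreeAlgebra.ι ℂ) c ∈ (annMinus (f b) z).comap (evalGen (f b)) := by
      rw [Ideal.mem_comap, mem_annMinus, hev, wordSum_smul, hc]
    have h2 := (Ideal.mem_torsionOf_iff _ _).1 (Ideal.mem_comap.1 (h h1))
    rw [← wordSum_smul, ← hev]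
    exact h2
  · intro h p hp
    have hp' : p ∈ gen (FreeAlgebra.ι ℂ (X := ι)) := by
      rw [gen, FreeAlgebra.adjoin_range_ι]; trivial
    obtain ⟨c, rfl⟩ := mem_gen_iff.1 hp'
    rw [Ideal.mem_comap, mem_annMinus, hev, wordSum_smul] at hp
    rw [Ideal.mem_comap, Ideal.mem_torsionOf_iff]
    have h2 := h c hp
    rw [← wordSum_smul, ← hev] at h2
    exact h2

theorem mem_singular_iff
    (hV : ⨆ μ : Module.Dual ℂ H, eigen (op V (t H)) (fun h => μ h) = ⊤)
    (hZ : ⨆ μ : Module.Dual ℂ H, eigen (op Z (t H)) (fun h => μ h) = ⊤) (u : V ⊗[ℂ] Z) :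
    u ∈ singular b V Z ↔ ∀ i, (op V (e b) i).rTensor Z u
      = (op Z (fun i => (-1 : ℂ) • e b i) i).lTensor V u := by
  rw [singular, mem_singularSpan_iff]
  · refine forall_congr' fun i => ?_
    rw [← tensorAction_tmul_one, ← tensorAction_one_tmul, TensorProduct.tmul_smul, map_smul,
      LinearMap.smul_apply, neg_one_smul, ← add_eq_zero_iff_eq_neg, ← LinearMap.add_apply,
      ← map_add]
    rfl
  · refine iSup_eigen_tensor hV hZ fun μ₁ μ₂ v hv z hz => ⟨μ₁ + μ₂, fun s => ?_⟩
    have h1 : t H s • v = μ₁ s • v := hv s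
    have h2 : t H s • z = μ₂ s • z := hz s
    have h3 : comul (s : 𝔤) = t H s ⊗ₜ[ℂ] 1 + 1 ⊗ₜ[ℂ] t H s := rfl
    beta_reduce
    rw [h3, map_add, LinearMap.add_apply, tensorAction_tmul, tensorAction_tmul, h1, h2, one_smul,
      one_smul, ← TensorProduct.smul_tmul', TensorProduct.tmul_smul, ← add_smul]
    rfl
  · intro i s
    -- `Δ(e_i)` raises weights by `α_i`, so moving `Δ(h)` to its left shifts it by the scalar
    -- `α_i(h)`.
    refine ⟨comul (s : 𝔤) - algebraMap ℂ _ (b.baseSupp i s), ?_⟩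
    have h1 : e b i * t H s = t H s * e b i - b.baseSupp i s • e b i := by
      rw [t_mul_e, add_sub_cancel_right]
    have h2 : comul (s : 𝔤) = t H s ⊗ₜ[ℂ] 1 + 1 ⊗ₜ[ℂ] t H s := rfl
    have h3 : comul (b.e i) = e b i ⊗ₜ[ℂ] 1 + 1 ⊗ₜ[ℂ] e b i := rfl
    rw [h2, h3, sub_mul, ← Algebra.smul_def]
    simp only [add_mul, mul_add, Algebra.TensorProduct.tmul_mul_tmul, one_mul, mul_one, smul_add,
      h1, TensorProduct.sub_tmul, TensorProduct.tmul_sub, TensorProduct.smul_tmul',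
      TensorProduct.tmul_smul]
    abel

end Tensor

end Classical

/-! ### Assembly of the quantum and the classical case -/

theorem QuantumGroup.isDualLowestVector_iff {ι : Type*} [Fintype ι] {𝔤 : Type*} [LieRing 𝔤]
    [LieAlgebra ℂ 𝔤] [FiniteDimensional ℂ 𝔤] [LieAlgebra.IsSemisimple ℂ 𝔤]
    {H : LieSubalgebra ℂ 𝔤} [H.IsCartanSubalgebra] {ħ : ℂ} {c : ℚ} {b : LieAlgebra.Basis ι H}
    {M : Type*} [AddCommGroup M] [Module ℂ M] [Module (QuantumGroup ħ c b) M]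
    [IsScalarTower ℂ (QuantumGroup ħ c b) M] {μ : Module.Dual ℂ H} {m : M} {φ : Module.Dual ℂ M} :
    IsDualLowestVector (QuantumGroup.k ħ c b) (qWeight ħ c b μ) m φ ↔ φ m = 1 ∧
      φ ∈ eigen (fun s => (op M (QAlg.kk ħ b.A (simpleForm c b)) s).dualMap)
        (QuantumGroup.weight ħ c b μ) :=
  and_congr_right fun _ => QuantumGroup.mem_eigen_dual.symm

theorem Classical.isDualLowestVector_iff {𝔤 : Type*} [LieRing 𝔤] [LieAlgebra ℂ 𝔤]
    {H : LieSubalgebra ℂ 𝔤} {M : Type*} [AddCommGroup M] [Module ℂ M]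
    [Module (UniversalEnvelopingAlgebra ℂ 𝔤) M] [IsScalarTower ℂ (UniversalEnvelopingAlgebra ℂ 𝔤) M]
    {μ : Module.Dual ℂ H} {m : M} {φ : Module.Dual ℂ M} :
    IsDualLowestVector (Classical.t H) (fun h => μ h) m φ ↔ φ m = 1 ∧
      φ ∈ eigen (fun s => (op M (Classical.t H) s).dualMap) (fun h => μ h) :=
  and_congr_right fun _ => Classical.mem_eigen_dual.symm

theorem word_neg_op {ι U N : Type*} [Ring U] [Algebra ℂ U] [AddCommGroup N] [Module ℂ N]
    [Module U N] [IsScalarTower ℂ U N] (e : ι → U) (a : List ι) (w : N) :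
    word (op N fun i => (-1 : ℂ) • e i) a w
      = ((-1 : ℂ) ^ a.length • (1 : Module.End ℂ N)) (word (op N e) a w) := by
  induction a generalizing w with
  | nil => simp
  | cons i a ih =>
    rw [word_cons, word_cons, Module.End.mul_apply, Module.End.mul_apply, ih]
    simp only [op_apply, LinearMap.smul_apply, Module.End.one_apply, smul_assoc, List.length_cons,
      pow_succ, mul_smul]
    rw [smul_comm (e i), smul_comm (-1 : ℂ)]

end Extremal

end

open scoped TensorProduct in
open Extremal in
theorem mainTheorem4 {ι : Type*} [Fintype ι] {𝔤 : Type*} [LieRing 𝔤] [LieAlgebra ℂ 𝔤]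
    [FiniteDimensional ℂ 𝔤] [LieAlgebra.IsSemisimple ℂ 𝔤]
    {H : LieSubalgebra ℂ 𝔤} [H.IsCartanSubalgebra] (b : LieAlgebra.Basis ι H)
    (ν ζ : Module.Dual ℂ H) :
    -- the quantum group, where `q = exp ħ` is not a root of unity
    (∀ (c : ℚ), c ≠ 0 → ∀ (ħ : ℂ), (∀ n : ℕ, 0 < n → Complex.exp ħ ^ n ≠ 1) →
      ∀ (V : Type*) [AddCommGroup V] [Module ℂ V] [Module (QuantumGroup ħ c b) V]
        [IsScalarTower ℂ (QuantumGroup ħ c b) V] [IsSimpleModule (QuantumGroup ħ c b) V]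
        (Z : Type*) [AddCommGroup Z] [Module ℂ Z] [Module (QuantumGroup ħ c b) Z]
        [IsScalarTower ℂ (QuantumGroup ħ c b) Z] [IsSimpleModule (QuantumGroup ħ c b) Z]
        (v : V) (z : Z),
      IsHighestVector (QuantumGroup.k ħ c b) (QuantumGroup.e ħ c b) (qWeight ħ c b ν) v →
      IsHighestVector (QuantumGroup.k ħ c b) (QuantumGroup.e ħ c b) (qWeight ħ c b ζ) z →
      (∃! φ : Module.Dual ℂ V,
        IsDualLowestVector (QuantumGroup.k ħ c b) (qWeight ħ c b ν) v φ) ∧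
      (∃! ψ : Module.Dual ℂ Z,
        IsDualLowestVector (QuantumGroup.k ħ c b) (qWeight ħ c b ζ) z ψ) ∧
      (∀ ψ : Module.Dual ℂ Z,
        IsDualLowestVector (QuantumGroup.k ħ c b) (qWeight ħ c b ζ) z ψ →
        ∃ Φ : QuantumGroup.singular ħ c b V Z ≃ₗ[ℂ] QuantumGroup.extremal ħ c b V z,
          ∀ u : QuantumGroup.singular ħ c b V Z, (Φ u : V) = leadingLeft V ψ (u : V ⊗[ℂ] Z)) ∧
      (∀ φ : Module.Dual ℂ V,
        IsDualLowestVector (QuantumGroup.k ħ c b) (qWeight ħ c b ν) v φ →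
        ∃ Φ : QuantumGroup.singular ħ c b V Z ≃ₗ[ℂ] QuantumGroup.extremal ħ c b Z v,
          ∀ u : QuantumGroup.singular ħ c b V Z,
            (Φ u : Z) = leadingRight Z φ (u : V ⊗[ℂ] Z))) ∧
    -- the classical universal enveloping algebra
    (∀ (V : Type*) [AddCommGroup V] [Module ℂ V] [Module (UniversalEnvelopingAlgebra ℂ 𝔤) V]
        [IsScalarTower ℂ (UniversalEnvelopingAlgebra ℂ 𝔤) V]
        [IsSimpleModule (UniversalEnvelopingAlgebra ℂ 𝔤) V]
        (Z : Type*) [AddCommGroup Z] [Module ℂ Z] [Module (UniversalEnvelopingAlgebra ℂ 𝔤) Z]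
        [IsScalarTower ℂ (UniversalEnvelopingAlgebra ℂ 𝔤) Z]
        [IsSimpleModule (UniversalEnvelopingAlgebra ℂ 𝔤) Z]
        (v : V) (z : Z),
      IsHighestVector (Classical.t H) (Classical.e b) (fun h => ν h) v →
      IsHighestVector (Classical.t H) (Classical.e b) (fun h => ζ h) z →
      (∃! φ : Module.Dual ℂ V, IsDualLowestVector (Classical.t H) (fun h => ν h) v φ) ∧
      (∃! ψ : Module.Dual ℂ Z, IsDualLowestVector (Classical.t H) (fun h => ζ h) z ψ) ∧
      (∀ ψ : Module.Dual ℂ Z, IsDualLowestVector (Classical.t H) (fun h => ζ h) z ψ →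
        ∃ Φ : Classical.singular b V Z ≃ₗ[ℂ] Classical.extremal b V z,
          ∀ u : Classical.singular b V Z, (Φ u : V) = leadingLeft V ψ (u : V ⊗[ℂ] Z)) ∧
      (∀ φ : Module.Dual ℂ V, IsDualLowestVector (Classical.t H) (fun h => ν h) v φ →
        ∃ Φ : Classical.singular b V Z ≃ₗ[ℂ] Classical.extremal b Z v,
          ∀ u : Classical.singular b V Z,
            (Φ u : Z) = leadingRight Z φ (u : V ⊗[ℂ] Z))) := by
  refine ⟨?_, ?_⟩
  · intro c hc ħ hq V _ _ _ _ _ Z _ _ _ _ _ v z hv hz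
    have hV := QuantumGroup.system_e hc hq hv
    have hZ := QuantumGroup.system_ke hc hq hz
    have hS := QuantumGroup.mem_singular_iff hV.iSup_eigen hZ.iSup_eigen
    simp only [QuantumGroup.isDualLowestVector_iff]
    refine ⟨hV.existsUnique_dual, hZ.existsUnique_dual, fun ψ hψ => ?_, fun φ hφ => ?_⟩
    · exact exists_leadingLeft_equiv_of_systems hV hZ hS
        (QAlg.mem_idealKer_idealPlus_iff z) hψ.1 hψ.2
    · refine exists_leadingRight_equiv_of_systems hV hZ hS (eZ := op Z (QuantumGroup.e ħ c b))
        (D := op Z (QAlg.twist ħ b.A (simpleForm c b))) (fun a => ?_) (fun a a' h => ?_)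
        (fun a w => ?_) (QAlg.mem_idealKer_idealPlus_iff v) hφ.1 hφ.2
      -- A left inverse of the twist in the algebra makes its action injective.
      · obtain ⟨y, hy⟩ := QAlg.exists_mul_twist (ħ := ħ) (A := b.A) (B := simpleForm c b) a
        refine Function.LeftInverse.injective (g := fun w => y • w) fun w => ?_
        beta_reduce
        rw [op_apply, ← mul_smul, hy, one_smul]
      · rw [op, op, QAlg.twist_perm QuantumGroup.simpleForm_comm h]
      · rw [word_op_apply, word_op_apply, op_apply, ← mul_smul, QAlg.word_ke]
  · intro V _ _ _ _ _ Z _ _ _ _ _ v z hv hz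
    have hV := Classical.system one_ne_zero hv
    have hZ := Classical.system (neg_ne_zero.2 one_ne_zero) hz
    simp only [one_smul] at hV
    have hS := Classical.mem_singular_iff (b := b) hV.iSup_eigen hZ.iSup_eigen
    simp only [Classical.isDualLowestVector_iff]
    refine ⟨hV.existsUnique_dual, hZ.existsUnique_dual, fun ψ hψ => ?_, fun φ hφ => ?_⟩
    · exact exists_leadingLeft_equiv_of_systems hV hZ hS (Classical.mem_extremal_iff z) hψ.1 hψ.2
    · refine exists_leadingRight_equiv_of_systems hV hZ hS (eZ := op Z (Classical.e b))
        -- In the classical case the twist is only the sign from `x_α = -e_α`.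
        (D := fun a => (-1 : ℂ) ^ a.length • 1) (fun a => ?_) (fun a a' h => ?_)
        (word_neg_op (Classical.e b)) (Classical.mem_extremal_iff v) hφ.1 hφ.2
      · exact smul_right_injective Z (pow_ne_zero _ (neg_ne_zero.2 one_ne_zero))
      · rw [h.length_eq]
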